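/- Let $K\ge 1$, let $\mu_1,\dots,\mu_K\in\mathbb R^2\cong\mathbb C$ be (unknown) means and $\sigma_1,\dots,\sigma_K>0$ (unknown) standard deviations, and assume that there is a unique optimal arm $k^\star$, i.e. $\|\mu_k\|<\|\mu_{k^\star}\|$ for every $k\neq k^\star$. Put $\Delta_k=\|\mu_{k^\star}\|-\|\mu_k\|$. *Weighted-information bandit.* In each round $t=1,2,\dots$ a power profile $p^t=(p^t_1,\dots,p^t_K)$, with $p^t_k\geq 0$ and $\sum_k p^t_k=1$, is chosen from the outcomes of the earlier rounds, and then an outcome $X^t_k$ of every arm is observed. Conditionally on the $\sigma$-algebra $\mathcal F_t$ generated by the outcomes of rounds $1,\dots,t-1$, the outcomes $X^t_1,\dots,X^t_K$ are independent and $X^t_k\sim\mathcal N\big(\mu_k,\tfrac{\sigma_k^2}{2p^t_k}I_2\big)$, i.e. $X^t_k$ has density $x\mapsto\frac{p^t_k}{\pi\sigma_k^2}\exp\big(-p^t_k\|x-\mu_k\|^2/\sigma_k^2\big)$ on $\mathbb R^2$. The cumulative regret is $R(T)=\sum_{t=1}^T\sum_{k=1}^K\Delta_k\,p^t_k$. *Weighted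 Thompson Sampling (WTS).* All arms have the same flat prior $dm\,dv$ for mean and variance $(m,v)\in\mathbb R^2\times(0,\infty)$, so that given $\mathcal F_t$ the marginal posterior law of the mean of arm $k$ has density proportional to $$m\mapsto\int_0^\infty\prod_{\ell=1}^{t-1}\frac{p^\ell_k}{\pi v}\exp\Big(-\frac{p^\ell_k\|X^\ell_k-m\|^2}{v}\Big)\,dv ,$$ independently over the arms. This posterior is proper from round $t=4$ on, almost surely. WTS plays $p^1_k=p^2_k=1/K$ for all $k$; in round $3$, where the posterior is still improper, it plays an arbitrary profile that is an $\mathcal F_3$-measurable function with strictly positive entries of sum $1$ (for instance $1/K$ again); and for $t\ge4$ $$p^t_k=\mathbb P\big(\|\tilde\mu_k(t)\|\ge\|\tilde\mu_i(t)\|\text{ for all } i\,\big|\,\mathcal F_t\big),$$ where, given $\mathcal F_t$, the vectors $\tilde\mu_1(t),\dots,\tilde\mu_K(t)$ are independent draws from the posterior laws of the means of the $K$ arms. **Theorem.** The regret $R(T)$ of WTS is integrable for every $T$, and $$\limsup_{T\to\infty}\frac{\mathbb E[R(T)]}{\log T}\;\le\;\sum_{k\ne k^\star}\frac{\sigma_k^2}{\Delta_k}.$$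 -/

import Mathlib

open MeasureTheory ProbabilityTheory Filter
open scoped ENNReal

noncomputable section

namespace WeightedBandit

/-- Density at `x` of the circularly symmetric Gaussian law on `ℂ = ℝ²` with mean `m` and total
variance `v = E ‖X - m‖²`, that is, of `N(m, (v / 2) I₂)`, for `0 < v`. -/
def gaussianDensity (m : ℂ) (v : ℝ) (x : ℂ) : ℝ :=
  (Real.pi * v)⁻¹ * Real.exp (-(‖x - m‖ ^ 2 / v))

/-- The circularly symmetric Gaussian law `N(m, (v / 2) I₂)` on `ℂ = ℝ²`, for `0 < v`. -/
def complexGaussian (m : ℂ) (v : ℝ) : Measure ℂ :=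
  volume.withDensity fun x => ENNReal.ofReal (gaussianDensity m v x)

/-- Joint law of the outcomes of one round, played with power profile `q`: the outcomes of the `K`
arms are independent, the one of arm `k` being `N(μ k, σ k ^ 2 / (2 * q k) I₂)`. -/
def outcomeLaw {K : ℕ} (μ : Fin K → ℂ) (σ : Fin K → ℝ) (q : Fin K → ℝ) : Measure (Fin K → ℂ) :=
  Measure.pi fun k => complexGaussian (μ k) (σ k ^ 2 / q k)

/-- Unnormalised marginal posterior density, at the point `m`, of the mean of one arm, after `n`
outcomes `x 0, …, x (n - 1)` observed with powers `q 0, …, q (n - 1)`. The mean and the variance are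
both unknown and have the flat prior `dm dv` on `ℂ × (0, ∞)`; the variance is integrated out. -/
def posteriorWeight (n : ℕ) (q : ℕ → ℝ) (x : ℕ → ℂ) (m : ℂ) : ℝ≥0∞ :=
  ∫⁻ v in Set.Ioi (0 : ℝ),
    ∏ l ∈ Finset.range n, ENNReal.ofReal (gaussianDensity m (v / q l) (x l))

/-- Marginal posterior law of the mean of one arm after `n` outcomes (proper for `3 ≤ n`, unless all
outcomes coincide). -/
def posterior (n : ℕ) (q : ℕ → ℝ) (x : ℕ → ℂ) : Measure ℂ :=
  (∫⁻ m, posteriorWeight n q x m)⁻¹ • volume.withDensity (posteriorWeight n q x)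

/-- Posterior probability, after `n` rounds with profiles `q` and outcomes `x`, that arm `k` is
optimal, i.e. has the mean of largest norm. The arms are independent under the posterior. -/
def posteriorOptimal {K : ℕ} (n : ℕ) (q : ℕ → Fin K → ℝ) (x : ℕ → Fin K → ℂ) (k : Fin K) : ℝ :=
  (Measure.pi fun i => posterior n (fun l => q l i) (fun l => x l i)).real
    {m | ∀ i, ‖m i‖ ≤ ‖m k‖}

/-- The σ-algebra generated by the outcomes of the first `n` rounds. -/
abbrev past {Ω : Type*} {K : ℕ} (X : ℕ → Ω → Fin K → ℂ) (n : ℕ) : MeasurableSpace Ω :=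
  ⨆ l : Fin n, MeasurableSpace.comap (X l) inferInstance

/-- `X n` (the outcomes of all arms in round `n + 1`) are the outcomes of the weighted-information
bandit with means `μ` and standard deviations `σ` when the power profiles `p` are played: given the
past, `X n` has the law `outcomeLaw μ σ (p n)`. -/
structure IsOutcome {Ω : Type*} [MeasurableSpace Ω] {K : ℕ} (P : Measure Ω)
    (μ : Fin K → ℂ) (σ : Fin K → ℝ) (p : ℕ → Ω → Fin K → ℝ) (X : ℕ → Ω → Fin K → ℂ) : Prop where
  measurable : ∀ n, Measurable (X n)
  condLaw : ∀ n (A : Set (Fin K → ℂ)), MeasurableSet A →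
    P⟦X n ⁻¹' A | past X n⟧ =ᵐ[P] fun ω => (outcomeLaw μ σ (p n ω)).real A

/-- `p n` (the power profile of round `n + 1`) is the profile of Weighted Thompson Sampling when the
outcomes are `X`: the first two profiles are uniform, and from the fourth round on the power of an
arm is its posterior probability of being optimal. Before the third round the posterior under the
flat prior is still improper, so any nonvanishing profile based on the past (such as the uniform
one) is allowed there. -/
structure IsWTS {Ω : Type*} {K : ℕ} (p : ℕ → Ω → Fin K → ℝ) (X : ℕ → Ω → Fin K → ℂ) : Prop where
  initial : ∀ n < 2, ∀ ω k, p n ω k = 1 / (K : ℝ)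
  third_measurable : Measurable[past X 2] (p 2)
  third_pos : ∀ ω k, 0 < p 2 ω k
  third_sum : ∀ ω, ∑ k, p 2 ω k = 1
  step : ∀ n, 3 ≤ n → ∀ ω k,
    p n ω k = posteriorOptimal n (fun l => p l ω) (fun l => X l ω) k

/-- The gap of arm `k`, if `kstar` is the optimal arm. -/
def gap {K : ℕ} (μ : Fin K → ℂ) (kstar k : Fin K) : ℝ := ‖μ kstar‖ - ‖μ k‖

/-- Cumulative regret up to round `T` of the power profiles `p`. -/
def regret {Ω : Type*} {K : ℕ} (μ : Fin K → ℂ) (kstar : Fin K) (p : ℕ → Ω → Fin K → ℝ)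
    (T : ℕ) (ω : Ω) : ℝ :=
  ∑ n ∈ Finset.range T, ∑ k, gap μ kstar k * p n ω k

end WeightedBandit

end

/-! By linearity it suffices that the expected total power of a suboptimal arm `k` is at most `B log
T + O(1)` for every `B > σ_k² / Δ_k²` (`exists_lintegral_power_le`).

Integrating out the variance turns the posterior of an arm after `n` rounds into a planar Student
law around the empirical mean `M`, with exact tail `P(‖m̃ - M‖ > r) = (V / (V + S r²))^(n-2)`. Here
`S` is the power collected by the arm (its information) and `V` the weighted residual sum of
squares, about `σ² n`. Fix a level `y` just below the optimal norm. If arm `k` wins, its sample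
exceeds `y` or all samples lie below `y`. The first event has probability about `exp(-S Δ_k² /
σ_k²)`, hence about `1 / T` once `S > B log T`; until then the arm spends at most `B log T + 1`.
This is the leading term. The second has probability at most `R` times the power of the optimal arm,
`R` being the posterior odds that the optimal arm lies below `y` (`posteriorOptimal_le_add`).

The errors are controlled by the martingale `W_n = (1 + S_n)⁻¹ exp(‖A_n‖² / (1 + S_n))`, a
likelihood ratio mixed over a Gaussian prior of means, where `A_n` is the weighted noise. An
empirical mean that is off by `η` forces `1 ≤ C e^(-cS) W` (`one_le_mul_mixture`), and the odds
satisfy `R ≤ C e^(-cS) (1 + W)` (`optimal_posterior_le`). Both errors come multiplied by the power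
`q_n` of the arm concerned. Under the expectation `W_n` may be replaced by `W_T`, so `E ∑ q_n e^(-c
S_n) W_n = E[W_T ∑ q_n e^(-c S_n)]`, and the inner sum is bounded pathwise because `q_n` is the
increment of `S_n` (`sum_lintegral_mixture_le`). No union bound over information levels is needed.

The bound on `R` compares a Student tail with `W`, and the coefficient of `‖A‖² / S` in the exponent
must match. The Student tail carries the random factor `σ² n / V`; on the typical event this costs
only a bounded amount, and atypical rounds have summable probability. -/

namespace WeightedBandit

/-! ### Planar integrals and the circular Gaussian law -/

lemma lintegral_complex_norm (g : ℝ → ℝ≥0∞) (hg : Measurable g) :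
    ∫⁻ z : ℂ, g ‖z‖ = ENNReal.ofReal (2 * Real.pi) *
      ∫⁻ r in Set.Ioi (0 : ℝ), ENNReal.ofReal r * g r := by
  rw [← Complex.lintegral_comp_polarCoord_symm, polarCoord_target, Measure.volume_eq_prod,
    ← Measure.prod_restrict, lintegral_prod _ (by simp only [Complex.norm_polarCoord_symm]; fun_prop)]
  simp only [Complex.norm_polarCoord_symm, lintegral_const, Measure.restrict_apply MeasurableSet.univ,
    Set.univ_inter, Real.volume_Ioo, smul_eq_mul]
  rw [← lintegral_const_mul _ (by fun_prop)]
  refine setLIntegral_congr_fun measurableSet_Ioi fun r hr => ?_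
  simp only [abs_of_pos (Set.mem_Ioi.1 hr), mul_comm]
  ring_nf

/-- In polar coordinates `A` contains a rectangle, whose angular width `2 * θ` factors out. This
gives lower bounds on posterior mass. -/
lemma lintegral_sector_le (g : ℝ → ℝ≥0∞) (hg : Measurable g) {r θ : ℝ} (hr : 0 ≤ r)
    (hθ : θ ≤ Real.pi) (A : Set ℂ) (hA : MeasurableSet A)
    (h : ∀ ρ φ : ℝ, r < ρ → |φ| < θ → (ρ * (Real.cos φ + Real.sin φ * Complex.I) : ℂ) ∈ A) :
    ENNReal.ofReal (2 * θ) * ∫⁻ ρ in Set.Ioi r, ENNReal.ofReal ρ * g ρ ≤ ∫⁻ z in A, g ‖z‖ := by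
  rw [← lintegral_indicator hA, ← Complex.lintegral_comp_polarCoord_symm, polarCoord_target]
  calc _ = ∫⁻ p in Set.Ioi r ×ˢ Set.Ioo (-θ) θ, ENNReal.ofReal p.1 * g p.1 := by
        rw [Measure.volume_eq_prod, ← Measure.prod_restrict, lintegral_prod _ (by fun_prop)]
        simp only [lintegral_const, Measure.restrict_apply MeasurableSet.univ,
          Set.univ_inter, Real.volume_Ioo]
        rw [← lintegral_const_mul _ (by fun_prop)]
        refine lintegral_congr fun r => ?_
        rw [mul_comm]
        ring_nf
    _ ≤ ∫⁻ p in Set.Ioi r ×ˢ Set.Ioo (-θ) θ, ENNReal.ofReal p.1 •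
          A.indicator (fun z => g ‖z‖) (Complex.polarCoord.symm p) := by
        refine setLIntegral_mono' (measurableSet_Ioi.prod measurableSet_Ioo) fun p hp => ?_
        obtain ⟨h1, h2⟩ := hp
        have hm := h p.1 p.2 h1 (abs_lt.2 h2)
        rw [Complex.polarCoord_symm_apply, Set.indicator_of_mem hm, ← Complex.polarCoord_symm_apply,
          Complex.norm_polarCoord_symm, abs_of_pos (hr.trans_lt h1), smul_eq_mul]
    _ ≤ _ := by
        refine lintegral_mono_set (Set.prod_mono (Set.Ioi_subset_Ioi hr) (Set.Ioo_subset_Ioo ?_ hθ))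
        linarith

/-- Gaussian integral over the plane. -/
lemma lintegral_exp_neg_mul_norm_sub_sq {b : ℝ} (hb : 0 < b) (c : ℂ) :
    ∫⁻ z : ℂ, ENNReal.ofReal (Real.exp (-b * ‖z - c‖ ^ 2)) = ENNReal.ofReal (Real.pi / b) := by
  rw [lintegral_sub_right_eq_self (fun z : ℂ => ENNReal.ofReal (Real.exp (-b * ‖z‖ ^ 2))) c]
  have h := GaussianFourier.integral_rexp_neg_mul_sq_norm (V := ℂ) hb
  rw [Complex.finrank_real_complex] at h
  norm_num at h
  rw [← ofReal_integral_eq_lintegral_ofReal ?_ (ae_of_all _ fun _ => (Real.exp_pos _).le)]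
  · simpa using congrArg ENNReal.ofReal h
  · refine Integrable.of_integral_ne_zero ?_
    have : Real.pi / b ≠ 0 := by positivity
    simpa [h] using this

lemma measurable_gaussianDensity (m : ℂ) : Measurable fun p : ℝ × ℂ => gaussianDensity m p.1 p.2 := by
  unfold gaussianDensity; fun_prop

lemma gaussianDensity_nonneg (m : ℂ) {v : ℝ} (hv : 0 ≤ v) (x : ℂ) : 0 ≤ gaussianDensity m v x := by
  unfold gaussianDensity; positivity

/-- The exponential-quadratic moments of a circularly symmetric Gaussian law. -/
lemma lintegral_complexGaussian_of_eq {m c : ℂ} {v a b : ℝ} (hv : 0 < v) (hb : 0 < b) (F : ℂ → ℝ)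
    (hF : Measurable F) (h : ∀ x, F x - ‖x - m‖ ^ 2 / v = a - b * ‖x - c‖ ^ 2) :
    ∫⁻ x, ENNReal.ofReal (Real.exp (F x)) ∂complexGaussian m v =
      ENNReal.ofReal (Real.exp a / (v * b)) := by
  unfold complexGaussian
  have hm : Measurable fun x => ENNReal.ofReal (gaussianDensity m v x) := by
    unfold gaussianDensity; fun_prop
  rw [lintegral_withDensity_eq_lintegral_mul _ hm (by fun_prop)]
  have : ∀ x, (fun x => ENNReal.ofReal (gaussianDensity m v x)) x * ENNReal.ofReal (Real.exp (F x)) =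
      ENNReal.ofReal ((Real.pi * v)⁻¹ * Real.exp a) *
        ENNReal.ofReal (Real.exp (-b * ‖x - c‖ ^ 2)) := fun x => by
    rw [← ENNReal.ofReal_mul (gaussianDensity_nonneg m hv.le x), ← ENNReal.ofReal_mul (by positivity),
      gaussianDensity, mul_assoc, ← Real.exp_add, mul_assoc, ← Real.exp_add]
    congr 3
    linarith [h x]
  simp only [Pi.mul_apply, this]
  rw [lintegral_const_mul _ (by fun_prop), lintegral_exp_neg_mul_norm_sub_sq hb,
    ← ENNReal.ofReal_mul (by positivity)]
  congr 1
  field_simp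

lemma complexGaussian_univ (m : ℂ) {v : ℝ} (hv : 0 < v) : complexGaussian m v Set.univ = 1 := by
  have := lintegral_complexGaussian_of_eq (m := m) (c := m) (a := 0) hv (inv_pos.2 hv) (fun _ => 0)
    measurable_const (fun x => by rw [zero_sub, zero_sub, div_eq_inv_mul])
  simpa [hv.ne'] using this

lemma complexGaussian_of_nonpos (m : ℂ) {v : ℝ} (hv : v ≤ 0) : complexGaussian m v = 0 := by
  unfold complexGaussian
  have : (fun x => ENNReal.ofReal (gaussianDensity m v x)) = 0 := by
    ext1 x
    refine ENNReal.ofReal_of_nonpos (mul_nonpos_of_nonpos_of_nonneg ?_ (Real.exp_pos _).le)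
    exact inv_nonpos.2 (mul_nonpos_of_nonneg_of_nonpos Real.pi_pos.le hv)
  rw [this, withDensity_zero]

instance (m : ℂ) (v : ℝ) : SigmaFinite (complexGaussian m v) := by
  unfold complexGaussian; infer_instance

/-- The value determines `v`, so the conditional probability of this single event reveals the power
that was played. -/
lemma complexGaussian_compl_ball (m : ℂ) {v : ℝ} (hv : 0 < v) :
    complexGaussian m v {x | 1 < ‖x - m‖} = ENNReal.ofReal (Real.exp (-(1 / v))) := by
  have hs : MeasurableSet {x : ℂ | 1 < ‖x - m‖} := measurableSet_lt measurable_const (by fun_prop)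
  unfold complexGaussian
  rw [withDensity_apply _ hs, ← lintegral_indicator hs]
  have h1 : ∀ x, Set.indicator {x : ℂ | 1 < ‖x - m‖} (fun x => ENNReal.ofReal (gaussianDensity m v x)) x
      = (fun r => Set.indicator (Set.Ioi 1) (fun r => ENNReal.ofReal
        ((Real.pi * v)⁻¹ * Real.exp (-(r ^ 2 / v)))) r) ‖x - m‖ := fun x => rfl
  simp only [h1]
  rw [lintegral_sub_right_eq_self (fun z : ℂ => (fun r => Set.indicator (Set.Ioi 1) (fun r =>
      ENNReal.ofReal ((Real.pi * v)⁻¹ * Real.exp (-(r ^ 2 / v)))) r) ‖z‖) m,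
    lintegral_complex_norm _ (by fun_prop (disch := exact measurableSet_Ioi))]
  have h2 : ∀ r : ℝ, ENNReal.ofReal r * Set.indicator (Set.Ioi 1) (fun r => ENNReal.ofReal
        ((Real.pi * v)⁻¹ * Real.exp (-(r ^ 2 / v)))) r = Set.indicator (Set.Ioi 1) (fun r =>
        ENNReal.ofReal (r * ((Real.pi * v)⁻¹ * Real.exp (-(r ^ 2 / v))))) r := fun r => by
    by_cases h : r ∈ Set.Ioi (1 : ℝ)
    · rw [Set.indicator_of_mem h, Set.indicator_of_mem h,
        ENNReal.ofReal_mul (zero_le_one.trans (Set.mem_Ioi.1 h).le)]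
    · simp [Set.indicator_of_notMem h]
  simp only [h2]
  rw [setLIntegral_indicator measurableSet_Ioi,
    Set.inter_eq_left.2 (Set.Ioi_subset_Ioi (zero_le_one' ℝ))]
  have hd : ∀ r ∈ Set.Ici (1 : ℝ), HasDerivAt (fun r => -(2 * Real.pi)⁻¹ * Real.exp (-(r ^ 2 / v)))
      (r * ((Real.pi * v)⁻¹ * Real.exp (-(r ^ 2 / v)))) r := fun r _ => by
    have := ((((hasDerivAt_id r).pow 2).div_const v).neg.exp).const_mul (-(2 * Real.pi)⁻¹)
    refine this.congr_deriv ?_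
    simp only [Pi.neg_apply, Pi.pow_apply, id]
    field_simp
    norm_num
  have hpos : ∀ r ∈ Set.Ioi (1 : ℝ), 0 ≤ r * ((Real.pi * v)⁻¹ * Real.exp (-(r ^ 2 / v))) :=
    fun r hr => by have : (0 : ℝ) < r := one_pos.trans hr
                   positivity
  have hl : Tendsto (fun r : ℝ => -(2 * Real.pi)⁻¹ * Real.exp (-(r ^ 2 / v))) atTop (nhds 0) := by
    rw [← mul_zero (-(2 * Real.pi)⁻¹)]
    refine Tendsto.const_mul _ (Real.tendsto_exp_atBot.comp ?_)
    refine tendsto_neg_atTop_atBot.comp ?_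
    exact (tendsto_pow_atTop two_ne_zero).atTop_div_const hv
  rw [← ofReal_integral_eq_lintegral_ofReal
    (integrableOn_Ioi_deriv_of_nonneg' hd hpos hl)
    ((ae_restrict_iff' measurableSet_Ioi).2 (ae_of_all _ hpos)),
    integral_Ioi_of_hasDerivAt_of_nonneg' hd hpos hl, ← ENNReal.ofReal_mul (by positivity)]
  congr 1
  norm_num
  field_simp

/-! ### The posterior as a planar Student law -/

lemma lintegral_inv_pow_mul_exp {D : ℝ} (hD : 0 < D) (n : ℕ) :
    ∫⁻ v in Set.Ioi (0 : ℝ), ENNReal.ofReal ((v⁻¹) ^ (n + 2) * Real.exp (-(D / v))) =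
      ENNReal.ofReal (Real.Gamma (n + 1) * ((D ^ (n + 1))⁻¹)) := by
  have h := Real.integral_rpow_mul_exp_neg_mul_Ioi (a := n + 1) (r := D) (by positivity) hD
  -- The substitution `v ↦ v⁻¹` leads to a Gamma integral; its Jacobian uses up two of the factors
  -- `v⁻¹`.
  have h' := integral_comp_rpow_Ioi (fun t : ℝ => t ^ ((n : ℝ) + 1 - 1) * Real.exp (-(D * t)))
    (p := -1) (by norm_num)
  have h2 : ∫ v in Set.Ioi (0 : ℝ), (v⁻¹) ^ (n + 2) * Real.exp (-(D / v)) =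
      Real.Gamma (n + 1) * ((D ^ (n + 1))⁻¹) := by
    rw [h] at h'
    rw [← inv_pow, ← one_div D, ← Real.rpow_natCast (1 / D), mul_comm, Nat.cast_add, Nat.cast_one,
      ← h']
    refine setIntegral_congr_fun measurableSet_Ioi fun v hv => ?_
    have hv : 0 < v := hv
    simp only [add_sub_cancel_right, Real.rpow_natCast, Real.rpow_neg_one, smul_eq_mul, abs_neg,
      abs_one, one_mul]
    rw [show (-1 - 1 : ℝ) = -((2 : ℕ) : ℝ) by norm_num, Real.rpow_neg hv.le, Real.rpow_natCast,
      pow_add, ← mul_assoc, ← inv_pow, div_eq_mul_inv, mul_comm (v⁻¹ ^ 2)]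
  have hpos : 0 < Real.Gamma (n + 1) * ((D ^ (n + 1))⁻¹) :=
    mul_pos (Real.Gamma_pos_of_pos (by positivity)) (by positivity)
  rw [← h2, ofReal_integral_eq_lintegral_ofReal]
  · exact Integrable.of_integral_ne_zero (by rw [h2]; exact hpos.ne')
  · refine (ae_restrict_iff' measurableSet_Ioi).2 (ae_of_all _ fun v hv => ?_)
    have hv : 0 < v := hv
    positivity

lemma prod_gaussianDensity (n : ℕ) (q : ℕ → ℝ) (x : ℕ → ℂ) (m : ℂ) {v : ℝ} (hv : 0 < v)
    (hq : ∀ l < n, 0 < q l) :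
    ∏ l ∈ Finset.range n, ENNReal.ofReal (gaussianDensity m (v / q l) (x l)) =
      ENNReal.ofReal (∏ l ∈ Finset.range n, (q l / Real.pi)) * ENNReal.ofReal ((v⁻¹) ^ n *
        Real.exp (-((∑ l ∈ Finset.range n, q l * ‖x l - m‖ ^ 2) / v))) := by
  have hq' : ∀ l ∈ Finset.range n, 0 < q l := fun l hl => hq l (Finset.mem_range.1 hl)
  rw [← ENNReal.ofReal_prod_of_nonneg fun l hl =>
      gaussianDensity_nonneg m (div_pos hv (hq' l hl)).le _, ← ENNReal.ofReal_mul
      (Finset.prod_nonneg fun l hl => (div_pos (hq' l hl) Real.pi_pos).le)]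
  congr 1
  rw [Finset.sum_div, ← Finset.sum_neg_distrib, Real.exp_sum, ← mul_assoc]
  conv_rhs => rw [← Finset.card_range n, ← Finset.prod_const, Finset.card_range,
    ← Finset.prod_mul_distrib, ← Finset.prod_mul_distrib]
  refine Finset.prod_congr rfl fun l hl => ?_
  have := hq' l hl
  unfold gaussianDensity
  rw [show ‖x l - m‖ ^ 2 / (v / q l) = q l * ‖x l - m‖ ^ 2 / v by field_simp]
  congr 1
  field_simp

lemma posteriorWeight_eq (n : ℕ) (q : ℕ → ℝ) (x : ℕ → ℂ) (m : ℂ) (hq : ∀ l < n + 2, 0 < q l)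
    (hD : 0 < ∑ l ∈ Finset.range (n + 2), q l * ‖x l - m‖ ^ 2) :
    posteriorWeight (n + 2) q x m = ENNReal.ofReal ((∏ l ∈ Finset.range (n + 2), (q l / Real.pi)) *
      Real.Gamma (n + 1)) *
      ENNReal.ofReal (((∑ l ∈ Finset.range (n + 2), q l * ‖x l - m‖ ^ 2) ^ (n + 1))⁻¹) := by
  unfold posteriorWeight
  rw [setLIntegral_congr_fun measurableSet_Ioi fun v hv => prod_gaussianDensity (n + 2) q x m hv hq,
    lintegral_const_mul _ (by fun_prop), lintegral_inv_pow_mul_exp hD,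
    ENNReal.ofReal_mul (Finset.prod_nonneg fun l hl =>
      (div_pos (hq l (Finset.mem_range.1 hl)) Real.pi_pos).le),
    ENNReal.ofReal_mul (Real.Gamma_pos_of_pos (by positivity)).le, mul_assoc]

/-- A weighted sum of squared distances, split at the weighted mean. -/
lemma sum_mul_norm_sub_sq (s : Finset ℕ) (q : ℕ → ℝ) (x : ℕ → ℂ) (m M : ℂ)
    (hM : ∑ l ∈ s, (q l : ℂ) * x l = ((∑ l ∈ s, q l : ℝ) : ℂ) * M) :
    ∑ l ∈ s, q l * ‖x l - m‖ ^ 2 =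
      ∑ l ∈ s, q l * ‖x l - M‖ ^ 2 + (∑ l ∈ s, q l) * ‖m - M‖ ^ 2 := by
  have hre := congrArg Complex.re hM
  have him := congrArg Complex.im hM
  simp only [Complex.re_sum, Complex.im_sum, Complex.re_ofReal_mul, Complex.im_ofReal_mul] at hre him
  have key : ∀ l, q l * ‖x l - m‖ ^ 2 = q l * ‖x l - M‖ ^ 2 + q l * ‖m - M‖ ^ 2 -
      2 * (m.re - M.re) * (q l * (x l).re - q l * M.re) -
      2 * (m.im - M.im) * (q l * (x l).im - q l * M.im) := fun l => by
    simp only [Complex.sq_norm, Complex.normSq_apply, Complex.sub_re, Complex.sub_im]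
    ring
  simp only [key, Finset.sum_sub_distrib, Finset.sum_add_distrib, ← Finset.mul_sum, hre, him,
    ← Finset.sum_mul]
  ring

/-- The planar Jacobian `ρ` makes the integrand an exact derivative, which is why the posterior tail
has a closed form. -/
lemma lintegral_Ioi_student {V S : ℝ} (hV : 0 < V) (hS : 0 < S) (k : ℕ) {r : ℝ} (hr : 0 ≤ r) :
    ∫⁻ ρ in Set.Ioi r, ENNReal.ofReal ρ * ENNReal.ofReal (((V + S * ρ ^ 2) ^ (k + 2))⁻¹) =
      ENNReal.ofReal ((2 * S * (k + 1))⁻¹ * ((V + S * r ^ 2) ^ (k + 1))⁻¹) := by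
  have hpos : ∀ ρ ∈ Set.Ioi r, 0 ≤ ρ * ((V + S * ρ ^ 2) ^ (k + 2))⁻¹ := fun ρ hρ => by
    have : 0 < ρ := hr.trans_lt hρ
    positivity
  have hd : ∀ ρ ∈ Set.Ici r, HasDerivAt
      (fun ρ => -(2 * S * (k + 1))⁻¹ * ((V + S * ρ ^ 2) ^ (k + 1))⁻¹)
      (ρ * ((V + S * ρ ^ 2) ^ (k + 2))⁻¹) ρ := fun ρ _ => by
    have hne : V + S * ρ ^ 2 ≠ 0 := by positivity
    have h1 : HasDerivAt (fun ρ => V + S * ρ ^ 2) (S * (2 * ρ)) ρ := by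
      simpa using ((hasDerivAt_pow 2 ρ).const_mul S).const_add V
    have := ((h1.pow (k + 1)).inv (pow_ne_zero _ hne)).const_mul (-(2 * S * (k + 1))⁻¹)
    refine this.congr_deriv ?_
    simp only [Pi.pow_apply, Nat.add_sub_cancel]
    push_cast
    field_simp
    ring
  have hl : Tendsto (fun ρ : ℝ => -(2 * S * (k + 1))⁻¹ * ((V + S * ρ ^ 2) ^ (k + 1))⁻¹) atTop
      (nhds 0) := by
    rw [← mul_zero (-(2 * S * (k + 1))⁻¹)]
    refine Tendsto.const_mul _ (tendsto_inv_atTop_zero.comp ?_)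
    refine (tendsto_pow_atTop (Nat.succ_ne_zero k)).comp (tendsto_atTop_add_const_left _ _ ?_)
    exact (tendsto_pow_atTop two_ne_zero).const_mul_atTop hS
  have h0 : ∀ ρ ∈ Set.Ioi r, ENNReal.ofReal ρ * ENNReal.ofReal (((V + S * ρ ^ 2) ^ (k + 2))⁻¹) =
      ENNReal.ofReal (ρ * ((V + S * ρ ^ 2) ^ (k + 2))⁻¹) := fun ρ hρ =>
    (ENNReal.ofReal_mul (hr.trans (Set.mem_Ioi.1 hρ).le)).symm
  rw [setLIntegral_congr_fun measurableSet_Ioi h0, ← ofReal_integral_eq_lintegral_ofReal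
    (integrableOn_Ioi_deriv_of_nonneg' hd hpos hl)
    ((ae_restrict_iff' measurableSet_Ioi).2 (ae_of_all _ hpos)),
    integral_Ioi_of_hasDerivAt_of_nonneg' hd hpos hl]
  congr 1
  ring

/-- Valid for improper posteriors too: in `ℝ≥0∞` the product `a⁻¹ * a` is at most one even for `a =
0` and `a = ∞`. -/
lemma posterior_univ_le (n : ℕ) (q : ℕ → ℝ) (x : ℕ → ℂ) : posterior n q x Set.univ ≤ 1 := by
  unfold posterior
  rw [Measure.smul_apply, withDensity_apply _ MeasurableSet.univ, Measure.restrict_univ, smul_eq_mul]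
  exact ENNReal.inv_mul_le_one _

instance (n : ℕ) (q : ℕ → ℝ) (x : ℕ → ℂ) : IsFiniteMeasure (posterior n q x) :=
  ⟨(posterior_univ_le n q x).trans_lt ENNReal.one_lt_top⟩

lemma posterior_real_le_one (n : ℕ) (q : ℕ → ℝ) (x : ℕ → ℂ) (A : Set ℂ) :
    (posterior n q x).real A ≤ 1 :=
  ENNReal.toReal_le_of_le_ofReal zero_le_one (by
    simpa using (measure_mono (Set.subset_univ A)).trans (posterior_univ_le n q x))

/-- The posterior law is a bivariate Student law. -/
lemma posterior_apply {n : ℕ} {q : ℕ → ℝ} {x : ℕ → ℂ} {M : ℂ} {V S : ℝ} (hq : ∀ l < n + 3, 0 < q l)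
    (hV : 0 < V) (hS : 0 < S)
    (hD : ∀ m, ∑ l ∈ Finset.range (n + 3), q l * ‖x l - m‖ ^ 2 = V + S * ‖m - M‖ ^ 2)
    {A : Set ℂ} (hA : MeasurableSet A) :
    posterior (n + 3) q x A = ENNReal.ofReal (S * (n + 1) * V ^ (n + 1) / Real.pi) *
      ∫⁻ m in A, ENNReal.ofReal (((V + S * ‖m - M‖ ^ 2) ^ (n + 2))⁻¹) := by
  set c : ℝ := (∏ l ∈ Finset.range (n + 3), (q l / Real.pi)) * Real.Gamma ((n + 1 : ℕ) + 1) with hc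
  have hcpos : 0 < c := mul_pos (Finset.prod_pos fun l hl =>
      (div_pos (hq l (Finset.mem_range.1 hl)) Real.pi_pos)) (Real.Gamma_pos_of_pos (by positivity))
  have hw : posteriorWeight (n + 3) q x = fun m => ENNReal.ofReal c *
      ENNReal.ofReal (((V + S * ‖m - M‖ ^ 2) ^ (n + 2))⁻¹) := by
    ext1 m
    have := posteriorWeight_eq (n + 1) q x m hq (by rw [hD m]; positivity)
    rw [hD m] at this
    exact this
  have hI : ∫⁻ m, ENNReal.ofReal (((V + S * ‖m - M‖ ^ 2) ^ (n + 2))⁻¹) =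
      ENNReal.ofReal (Real.pi / (S * (n + 1) * V ^ (n + 1))) := by
    rw [lintegral_sub_right_eq_self (fun m : ℂ =>
        ENNReal.ofReal (((V + S * ‖m‖ ^ 2) ^ (n + 2))⁻¹)) M,
      lintegral_complex_norm (fun r => ENNReal.ofReal (((V + S * r ^ 2) ^ (n + 2))⁻¹)) (by fun_prop),
      lintegral_Ioi_student hV hS n le_rfl, ← ENNReal.ofReal_mul (by positivity)]
    congr 1
    norm_num
    field_simp
  unfold posterior
  rw [Measure.smul_apply, withDensity_apply _ hA, smul_eq_mul, hw,
    lintegral_const_mul _ (by fun_prop), lintegral_const_mul _ (by fun_prop), hI,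
    ENNReal.mul_inv (Or.inr ENNReal.ofReal_ne_top)
      (Or.inl ENNReal.ofReal_ne_top), mul_mul_mul_comm,
    ENNReal.inv_mul_cancel (ENNReal.ofReal_pos.2 hcpos).ne' ENNReal.ofReal_ne_top, one_mul,
    ← ENNReal.ofReal_inv_of_pos (by positivity), inv_div]

lemma posterior_real_le {n : ℕ} {q : ℕ → ℝ} {x : ℕ → ℂ} {M : ℂ} {V S : ℝ}
    (hq : ∀ l < n + 3, 0 < q l) (hV : 0 < V) (hS : 0 < S)
    (hD : ∀ m, ∑ l ∈ Finset.range (n + 3), q l * ‖x l - m‖ ^ 2 = V + S * ‖m - M‖ ^ 2)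
    {A : Set ℂ} {r : ℝ} (hr : 0 ≤ r) (h : ∀ m ∈ A, r < ‖m - M‖) :
    (posterior (n + 3) q x).real A ≤ (V / (V + S * r ^ 2)) ^ (n + 1) := by
  have hB : MeasurableSet {m : ℂ | r < ‖m - M‖} := measurableSet_lt measurable_const (by fun_prop)
  refine ENNReal.toReal_le_of_le_ofReal (by positivity) ((measure_mono (t := {m | r < ‖m - M‖}) h).trans ?_)
  rw [posterior_apply hq hV hS hD hB, ← lintegral_indicator hB]
  have h1 : ∀ m, Set.indicator {m : ℂ | r < ‖m - M‖}
      (fun m => ENNReal.ofReal (((V + S * ‖m - M‖ ^ 2) ^ (n + 2))⁻¹)) m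
      = (fun ρ => Set.indicator (Set.Ioi r) (fun ρ => ENNReal.ofReal
        (((V + S * ρ ^ 2) ^ (n + 2))⁻¹)) ρ) ‖m - M‖ := fun x => rfl
  simp only [h1]
  rw [lintegral_sub_right_eq_self (fun z : ℂ => (fun ρ => Set.indicator (Set.Ioi r) (fun ρ =>
      ENNReal.ofReal (((V + S * ρ ^ 2) ^ (n + 2))⁻¹)) ρ) ‖z‖) M,
    lintegral_complex_norm _ (by fun_prop (disch := exact measurableSet_Ioi))]
  have h2 : ∀ ρ : ℝ, ENNReal.ofReal ρ * Set.indicator (Set.Ioi r) (fun ρ => ENNReal.ofReal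
        (((V + S * ρ ^ 2) ^ (n + 2))⁻¹)) ρ = Set.indicator (Set.Ioi r) (fun ρ =>
        ENNReal.ofReal ρ * ENNReal.ofReal (((V + S * ρ ^ 2) ^ (n + 2))⁻¹)) ρ := fun ρ => by
    by_cases h : ρ ∈ Set.Ioi r
    · rw [Set.indicator_of_mem h, Set.indicator_of_mem h]
    · simp [Set.indicator_of_notMem h]
  simp only [h2]
  rw [setLIntegral_indicator measurableSet_Ioi,
    Set.inter_eq_left.2 (Set.Ioi_subset_Ioi hr), lintegral_Ioi_student hV hS n hr,
    ← ENNReal.ofReal_mul (by positivity), ← ENNReal.ofReal_mul (by positivity)]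
  refine ENNReal.ofReal_le_ofReal (le_of_eq ?_)
  rw [div_pow]
  field_simp

/-- The law is invariant under rotations about `M`, so a sector of half-angle `θ`, with axis `u`,
carries the share `θ / π` of the tail. -/
lemma le_posterior_real {n : ℕ} {q : ℕ → ℝ} {x : ℕ → ℂ} {M u : ℂ} {V S : ℝ}
    (hq : ∀ l < n + 3, 0 < q l) (hV : 0 < V) (hS : 0 < S) (hu : ‖u‖ = 1)
    (hD : ∀ m, ∑ l ∈ Finset.range (n + 3), q l * ‖x l - m‖ ^ 2 = V + S * ‖m - M‖ ^ 2)
    {A : Set ℂ} (hA : MeasurableSet A) {r θ : ℝ} (hr : 0 ≤ r) (hθ0 : 0 ≤ θ) (hθ : θ ≤ Real.pi)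
    (h : ∀ ρ φ : ℝ, r < ρ → |φ| < θ →
      M + u * (ρ * (Real.cos φ + Real.sin φ * Complex.I) : ℂ) ∈ A) :
    θ / Real.pi * (V / (V + S * r ^ 2)) ^ (n + 1) ≤ (posterior (n + 3) q x).real A := by
  refine (ENNReal.ofReal_le_iff_le_toReal (measure_ne_top _ _)).1 ?_
  have hT : MeasurePreserving (fun z : ℂ => M + u * z) volume volume :=
    (measurePreserving_add_left volume M).comp
      (LinearIsometryEquiv.measurePreserving (rotation ⟨u, mem_sphere_zero_iff_norm.2 hu⟩))
  have hT' : MeasurableSet ((fun z : ℂ => M + u * z) ⁻¹' A) := hT.measurable hA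
  have hn : ∀ z, ‖M + u * z - M‖ = ‖z‖ := fun z => by simp [hu]
  have h1 := lintegral_sector_le (fun ρ => ENNReal.ofReal (((V + S * ρ ^ 2) ^ (n + 2))⁻¹))
    (by fun_prop) hr hθ _ hT' h
  rw [lintegral_Ioi_student hV hS n hr, ← ENNReal.ofReal_mul (by positivity)] at h1
  rw [posterior_apply hq hV hS hD hA, ← hT.setLIntegral_comp_preimage hA (by fun_prop)]
  simp only [hn]
  refine le_trans (le_of_eq ?_) (mul_le_mul_right h1 _)
  rw [← ENNReal.ofReal_mul (by positivity), div_pow]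
  congr 1
  field_simp

/-! ### One arm with predictable powers -/

lemma lintegral_of_condLaw {α Ω : Type*} [MeasurableSpace α] [MeasurableSpace Ω] {P : Measure Ω}
    [IsFiniteMeasure P] {g : Ω → α} (hg : Measurable g) {x : Ω → ℂ} (hx : Measurable x)
    {v : α → ℝ} (hv : Measurable v) (m : ℂ)
    (h : ∀ B C, MeasurableSet B → MeasurableSet C →
      P (g ⁻¹' B ∩ x ⁻¹' C) = ∫⁻ ω in g ⁻¹' B, complexGaussian m (v (g ω)) C ∂P)
    {F : α × ℂ → ℝ≥0∞} (hF : Measurable F) :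
    ∫⁻ ω, F (g ω, x ω) ∂P = ∫⁻ ω, ∫⁻ y, F (g ω, y) ∂complexGaussian m (v (g ω)) ∂P := by
  have hf : Measurable (Function.uncurry fun a y => ENNReal.ofReal (gaussianDensity m (v a) y)) :=
    ENNReal.measurable_ofReal.comp ((measurable_gaussianDensity m).comp
      ((hv.comp measurable_fst).prodMk measurable_snd))
  let κ : Kernel α ℂ := Kernel.withDensity (Kernel.const α (volume : Measure ℂ))
    fun a y => ENNReal.ofReal (gaussianDensity m (v a) y)
  have : IsSFiniteKernel κ := Kernel.IsSFiniteKernel.withDensity _ fun _ _ => ENNReal.ofReal_ne_top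
  have hκ : ∀ a, κ a = complexGaussian m (v a) := fun a => by
    rw [Kernel.withDensity_apply _ hf, Kernel.const_apply, complexGaussian]
  have hmap : P.map (fun ω => (g ω, x ω)) = (P.map g) ⊗ₘ κ := by
    -- The hypothesis on rectangles identifies the joint law with a kernel composition; Tonelli does
    -- the rest.
    refine Measure.ext_prod fun {B C} hB hC => ?_
    rw [Measure.map_apply (hg.prodMk hx) (hB.prod hC), Measure.compProd_apply_prod hB hC,
      setLIntegral_map hB (κ.measurable_coe hC) hg]
    simp only [hκ]
    exact h B C hB hC
  rw [← lintegral_map (f := F) hF (hg.prodMk hx), hmap, Measure.lintegral_compProd hF,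
    lintegral_map (hF.lintegral_kernel_prod_right' (κ := κ)) hg]
  simp only [hκ]

/-- The outcomes `x` of one arm with mean `m` and standard deviation `s`, which is played with the
`ℱ`-predictable powers `q`. -/
structure IsGaussianArm {Ω : Type*} [mΩ : MeasurableSpace Ω] (P : Measure Ω)
    (ℱ : ℕ → MeasurableSpace Ω) (m : ℂ) (s : ℝ) (q : ℕ → Ω → ℝ) (x : ℕ → Ω → ℂ) : Prop where
  sd_pos : 0 < s
  le : ∀ n, ℱ n ≤ mΩ
  mono : Monotone ℱ
  measurable_power : ∀ n, Measurable[ℱ n] (q n)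
  power_pos : ∀ n ω, 0 < q n ω
  power_le : ∀ n ω, q n ω ≤ 1
  measurable_outcome : ∀ n, Measurable[ℱ (n + 1)] (x n)
  law : ∀ n (B : Set Ω) (C : Set ℂ), MeasurableSet[ℱ n] B → MeasurableSet C →
    P (B ∩ x n ⁻¹' C) = ∫⁻ ω in B, complexGaussian m (s ^ 2 / q n ω) C ∂P

/-! ### Statistics of an arm and the mixture martingale -/

section Processes

variable {Ω : Type*} (m : ℂ) (s : ℝ) (q : ℕ → Ω → ℝ) (x : ℕ → Ω → ℂ)

/-- Information gathered in the first `n` rounds. -/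
noncomputable def info (n : ℕ) (ω : Ω) : ℝ := ∑ l ∈ Finset.range n, q l ω

/-- Weighted sum of the standardised deviations of the outcomes from the mean. -/
noncomputable def deviation (n : ℕ) (ω : Ω) : ℂ := ∑ l ∈ Finset.range n, ((q l ω / s : ℝ) : ℂ) * (x l ω - m)

/-- Weighted sum of the standardised squared deviations of the outcomes from the mean. -/
noncomputable def sqDeviation (n : ℕ) (ω : Ω) : ℝ := ∑ l ∈ Finset.range n, q l ω * ‖x l ω - m‖ ^ 2 / s ^ 2

/-- The mixture likelihood ratio martingale. -/
noncomputable def mixture (n : ℕ) (ω : Ω) : ℝ :=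
  (1 + info q n ω)⁻¹ * Real.exp (‖deviation m s q x n ω‖ ^ 2 / (1 + info q n ω))

end Processes

/-- One-step martingale property, by completing the square in `y`. The Gaussian normalisation
contributes `(1 + S + q) / (1 + S)`, which is exactly the change of the prefactor. -/
lemma lintegral_mixture_step (m A : ℂ) {s S q : ℝ} (hs : 0 < s) (hS : 0 ≤ S) (hq : 0 < q) :
    ∫⁻ y, ENNReal.ofReal ((1 + (S + q))⁻¹ * Real.exp (‖A + ((q / s : ℝ) : ℂ) * (y - m)‖ ^ 2 /
      (1 + (S + q)))) ∂complexGaussian m (s ^ 2 / q) =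
    ENNReal.ofReal ((1 + S)⁻¹ * Real.exp (‖A‖ ^ 2 / (1 + S))) := by
  have h := lintegral_complexGaussian_of_eq (m := m) (c := m + ((s / (1 + S) : ℝ) : ℂ) * A)
    (v := s ^ 2 / q) (a := ‖A‖ ^ 2 / (1 + S)) (b := q * (1 + S) / (s ^ 2 * (1 + (S + q))))
    (by positivity) (by positivity)
    (fun y => ‖A + ((q / s : ℝ) : ℂ) * (y - m)‖ ^ 2 / (1 + (S + q))) (by fun_prop) (fun y => by
      simp only [Complex.sq_norm, Complex.normSq_apply, Complex.sub_re, Complex.sub_im,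
        Complex.add_re, Complex.add_im, Complex.re_ofReal_mul, Complex.im_ofReal_mul]
      field_simp
      ring)
  simp only [ENNReal.ofReal_mul (show 0 ≤ (1 + (S + q))⁻¹ by positivity)]
  rw [lintegral_const_mul _ (by fun_prop), h, ← ENNReal.ofReal_mul (by positivity)]
  congr 1
  field_simp

/-- Whatever the power, `q * ‖y - m‖ ^ 2 / s ^ 2` is a standard exponential variable, so the powers
drop out. -/
lemma lintegral_exp_sq_step (m : ℂ) {s q t : ℝ} (hs : 0 < s) (hq : 0 < q) (ht : -1 < t) :
    ∫⁻ y, ENNReal.ofReal (Real.exp (-t * (q * ‖y - m‖ ^ 2 / s ^ 2))) ∂complexGaussian m (s ^ 2 / q) =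
    ENNReal.ofReal ((1 + t)⁻¹) := by
  have ht' : 0 < 1 + t := by linarith
  have h := lintegral_complexGaussian_of_eq (m := m) (c := m) (v := s ^ 2 / q) (a := 0)
    (b := (1 + t) * q / s ^ 2) (by positivity) (by positivity)
    (fun y => -t * (q * ‖y - m‖ ^ 2 / s ^ 2)) (by fun_prop) (fun y => by
      field_simp
      ring)
  rw [h, Real.exp_zero]
  congr 1
  field_simp

/-- Discrete form of `∫ exp(-c S) dS < ∞`: by convexity of `exp` and `q n ≤ 1`, each term is bounded
by a multiple of an increment of `-exp(-c S)`, and the increments telescope. -/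
lemma sum_mul_exp_neg_le {c : ℝ} (hc : 0 < c) (q : ℕ → ℝ) (h0 : ∀ n, 0 ≤ q n) (h1 : ∀ n, q n ≤ 1)
    (T : ℕ) : ∑ n ∈ Finset.range T, q n * Real.exp (-c * ∑ l ∈ Finset.range n, q l) ≤
      (1 - Real.exp (-c))⁻¹ := by
  have hpos : 0 < 1 - Real.exp (-c) := by
    rw [sub_pos, Real.exp_lt_one_iff]; linarith
  rw [← one_div, le_div_iff₀' hpos]
  suffices h : (1 - Real.exp (-c)) * ∑ n ∈ Finset.range T, q n *
      Real.exp (-c * ∑ l ∈ Finset.range n, q l) ≤ 1 - Real.exp (-c * ∑ l ∈ Finset.range T, q l) from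
    h.trans (by linarith [Real.exp_pos (-c * ∑ l ∈ Finset.range T, q l)])
  induction T with
  | zero => simp
  | succ T ih =>
    rw [Finset.sum_range_succ, Finset.sum_range_succ, mul_add, mul_add, Real.exp_add]
    have hconv : Real.exp (-c * q T) ≤ 1 - q T * (1 - Real.exp (-c)) := by
      have := convexOn_exp.2 (Set.mem_univ 0) (Set.mem_univ (-c)) (sub_nonneg.2 (h1 T)) (h0 T)
        (by ring)
      simp only [smul_eq_mul, mul_zero, zero_add, Real.exp_zero] at this
      rw [mul_comm (q T)] at this
      linarith
    nlinarith [mul_le_mul_of_nonneg_left hconv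
      (Real.exp_pos (-c * ∑ l ∈ Finset.range T, q l)).le]

namespace IsGaussianArm

variable {Ω : Type*} [mΩ : MeasurableSpace Ω] {P : Measure Ω} {ℱ : ℕ → MeasurableSpace Ω} {m : ℂ}
  {s : ℝ} {q : ℕ → Ω → ℝ} {x : ℕ → Ω → ℂ}

lemma info_nonneg (h : IsGaussianArm P ℱ m s q x) (n : ℕ) (ω : Ω) : 0 ≤ info q n ω :=
  Finset.sum_nonneg fun l _ => (h.power_pos l ω).le

lemma info_le (h : IsGaussianArm P ℱ m s q x) (n : ℕ) (ω : Ω) : info q n ω ≤ n := by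
  simpa [info] using Finset.sum_le_sum fun l (_ : l ∈ Finset.range n) => h.power_le l ω

lemma measurable_power' (h : IsGaussianArm P ℱ m s q x) {l n : ℕ} (hl : l ≤ n) :
    Measurable[ℱ n] (q l) := (h.measurable_power l).mono (h.mono hl) le_rfl

lemma measurable_outcome' (h : IsGaussianArm P ℱ m s q x) {l n : ℕ} (hl : l < n) :
    Measurable[ℱ n] (x l) := (h.measurable_outcome l).mono (h.mono hl) le_rfl

lemma measurable_info (h : IsGaussianArm P ℱ m s q x) (n : ℕ) : Measurable[ℱ n] (info q n) := by
  unfold info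
  exact Finset.measurable_fun_sum _ fun l hl => h.measurable_power' (Finset.mem_range.1 hl).le

lemma measurable_deviation (h : IsGaussianArm P ℱ m s q x) (n : ℕ) :
    Measurable[ℱ n] (deviation m s q x n) := by
  unfold deviation
  refine Finset.measurable_fun_sum _ fun l hl => ?_
  have h1 := h.measurable_power' (Finset.mem_range.1 hl).le
  have h2 := h.measurable_outcome' (Finset.mem_range.1 hl)
  exact (Complex.measurable_ofReal.comp (h1.div_const s)).mul (h2.sub_const m)

lemma measurable_sqDeviation (h : IsGaussianArm P ℱ m s q x) (n : ℕ) :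
    Measurable[ℱ n] (sqDeviation m s q x n) := by
  unfold sqDeviation
  refine Finset.measurable_fun_sum _ fun l hl => ?_
  have h1 := h.measurable_power' (Finset.mem_range.1 hl).le
  have h2 := h.measurable_outcome' (Finset.mem_range.1 hl)
  exact (h1.mul (Measurable.comp (g := fun z : ℂ => ‖z - m‖ ^ 2) (by fun_prop) h2)).div_const _

lemma measurable_mixture (h : IsGaussianArm P ℱ m s q x) (n : ℕ) :
    Measurable[ℱ n] (mixture m s q x n) := by
  unfold mixture
  have h1 := (h.measurable_info n).const_add 1
  exact h1.inv.mul (Real.measurable_exp.comp ((Measurable.comp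
    (g := fun z : ℂ => ‖z‖ ^ 2) (by fun_prop) (h.measurable_deviation n)).div h1))

lemma mixture_nonneg (h : IsGaussianArm P ℱ m s q x) (n : ℕ) (ω : Ω) : 0 ≤ mixture m s q x n ω :=
  mul_nonneg (inv_nonneg.2 (by linarith [h.info_nonneg n ω])) (Real.exp_pos _).le

lemma lintegral_outcome [IsFiniteMeasure P] (h : IsGaussianArm P ℱ m s q x) {n : ℕ} {α : Type*}
    [MeasurableSpace α] {g : Ω → α} (hg : Measurable[ℱ n] g) {v : α → ℝ} (hv : Measurable v)
    (hvq : ∀ ω, v (g ω) = s ^ 2 / q n ω) {F : α × ℂ → ℝ≥0∞} (hF : Measurable F) :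
    ∫⁻ ω, F (g ω, x n ω) ∂P = ∫⁻ ω, ∫⁻ y, F (g ω, y) ∂complexGaussian m (s ^ 2 / q n ω) ∂P := by
  rw [lintegral_of_condLaw (hg.mono (h.le n) le_rfl)
    ((h.measurable_outcome n).mono (h.le (n + 1)) le_rfl) hv m _ hF]
  · simp only [hvq]
  · intro B C hB hC
    simp only [hvq]
    exact h.law n _ C (hg hB) hC

lemma lintegral_mul_mixture_succ [IsFiniteMeasure P] (h : IsGaussianArm P ℱ m s q x) {n : ℕ}
    {G : Ω → ℝ≥0∞} (hG : Measurable[ℱ n] G) :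
    ∫⁻ ω, G ω * ENNReal.ofReal (mixture m s q x (n + 1) ω) ∂P =
      ∫⁻ ω, G ω * ENNReal.ofReal (mixture m s q x n ω) ∂P := by
  have hg : Measurable[ℱ n] fun ω => (G ω, q n ω, info q n ω, deviation m s q x n ω) :=
    hG.prodMk ((h.measurable_power n).prodMk
      ((h.measurable_info n).prodMk (h.measurable_deviation n)))
  have key := h.lintegral_outcome hg (v := fun a => s ^ 2 / a.2.1) (by fun_prop) (fun _ => rfl)
    (F := fun b => b.1.1 * ENNReal.ofReal ((1 + (b.1.2.2.1 + b.1.2.1))⁻¹ *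
      Real.exp (‖b.1.2.2.2 + ((b.1.2.1 / s : ℝ) : ℂ) * (b.2 - m)‖ ^ 2 /
        (1 + (b.1.2.2.1 + b.1.2.1))))) (by fun_prop)
  simp only at key
  calc _ = _ := by
        refine lintegral_congr fun ω => ?_
        simp only [mixture, info, deviation, Finset.sum_range_succ]
    _ = _ := key
    _ = _ := lintegral_congr fun ω => by
        rw [lintegral_const_mul _ (by fun_prop),
          lintegral_mixture_step m _ h.sd_pos (h.info_nonneg n ω) (h.power_pos n ω), mixture]

lemma lintegral_mul_mixture [IsFiniteMeasure P] (h : IsGaussianArm P ℱ m s q x) {n N : ℕ}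
    (hN : n ≤ N) {G : Ω → ℝ≥0∞} (hG : Measurable[ℱ n] G) :
    ∫⁻ ω, G ω * ENNReal.ofReal (mixture m s q x N ω) ∂P =
      ∫⁻ ω, G ω * ENNReal.ofReal (mixture m s q x n ω) ∂P := by
  induction N, hN using Nat.le_induction with
  | base => rfl
  | succ N hN ih =>
    rw [h.lintegral_mul_mixture_succ (hG.mono (h.mono hN) le_rfl), ih]

lemma lintegral_mixture [IsProbabilityMeasure P] (h : IsGaussianArm P ℱ m s q x) (n : ℕ) :
    ∫⁻ ω, ENNReal.ofReal (mixture m s q x n ω) ∂P = 1 := by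
  have := h.lintegral_mul_mixture (Nat.zero_le n) (G := fun _ => 1) measurable_const
  simpa [mixture, info, deviation] using this

/-- Change of measure: against the mixture martingale, weights which decay exponentially with the
information have a bounded sum. -/
lemma sum_lintegral_mixture_le [IsProbabilityMeasure P] (h : IsGaussianArm P ℱ m s q x) {c : ℝ}
    (hc : 0 < c) (T : ℕ) :
    ∑ n ∈ Finset.range T, ∫⁻ ω, ENNReal.ofReal (q n ω * Real.exp (-c * info q n ω) *
      mixture m s q x n ω) ∂P ≤ ENNReal.ofReal ((1 - Real.exp (-c))⁻¹) := by
  have hpos : ∀ n ω, 0 ≤ q n ω * Real.exp (-c * info q n ω) := fun n ω =>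
    mul_nonneg (h.power_pos n ω).le (Real.exp_pos _).le
  have hm : ∀ n, Measurable[ℱ n] fun ω => ENNReal.ofReal (q n ω * Real.exp (-c * info q n ω)) :=
    fun n => ENNReal.measurable_ofReal.comp ((h.measurable_power n).mul
      (Real.measurable_exp.comp ((h.measurable_info n).const_mul (-c))))
  -- All terms are moved to the common density at time `T`, so that the weights can be summed
  -- pathwise before integrating.
  calc _ = ∑ n ∈ Finset.range T, ∫⁻ ω, ENNReal.ofReal (q n ω * Real.exp (-c * info q n ω)) *
        ENNReal.ofReal (mixture m s q x T ω) ∂P := Finset.sum_congr rfl fun n hn => by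
          rw [h.lintegral_mul_mixture (Finset.mem_range.1 hn).le (hm n)]
          simp only [ENNReal.ofReal_mul (hpos n _)]
    _ = ∫⁻ ω, ENNReal.ofReal (∑ n ∈ Finset.range T, q n ω * Real.exp (-c * info q n ω)) *
        ENNReal.ofReal (mixture m s q x T ω) ∂P := by
          rw [← lintegral_finsetSum]
          · refine lintegral_congr fun ω => ?_
            rw [ENNReal.ofReal_sum_of_nonneg fun n _ => hpos n ω, Finset.sum_mul]
          · exact fun n _ => ((hm n).mono (h.le n) le_rfl).mul
              (ENNReal.measurable_ofReal.comp ((h.measurable_mixture T).mono (h.le T) le_rfl))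
    _ ≤ ∫⁻ ω, ENNReal.ofReal ((1 - Real.exp (-c))⁻¹) * ENNReal.ofReal (mixture m s q x T ω) ∂P := by
          refine lintegral_mono fun ω => mul_le_mul_left (ENNReal.ofReal_le_ofReal ?_) _
          exact sum_mul_exp_neg_le hc (fun n => q n ω) (fun n => (h.power_pos n ω).le)
            (fun n => h.power_le n ω) T
    _ = _ := by
          rw [lintegral_const_mul' _ _ ENNReal.ofReal_ne_top, h.lintegral_mixture, mul_one]

lemma lintegral_exp_sqDeviation [IsProbabilityMeasure P] (h : IsGaussianArm P ℱ m s q x) {t : ℝ}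
    (ht : -1 < t) (n : ℕ) :
    ∫⁻ ω, ENNReal.ofReal (Real.exp (-t * sqDeviation m s q x n ω)) ∂P =
      ENNReal.ofReal ((1 + t)⁻¹ ^ n) := by
  have ht' : 0 < 1 + t := by linarith
  induction n with
  | zero => simp [sqDeviation]
  | succ n ih =>
    have hg : Measurable[ℱ n] fun ω => (q n ω, sqDeviation m s q x n ω) :=
      (h.measurable_power n).prodMk (h.measurable_sqDeviation n)
    have key := h.lintegral_outcome hg (v := fun a => s ^ 2 / a.1) (by fun_prop) (fun _ => rfl)
      (F := fun b => ENNReal.ofReal (Real.exp (-t * b.1.2)) *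
        ENNReal.ofReal (Real.exp (-t * (b.1.1 * ‖b.2 - m‖ ^ 2 / s ^ 2)))) (by fun_prop)
    simp only at key
    calc _ = _ := by
          refine lintegral_congr fun ω => ?_
          rw [← ENNReal.ofReal_mul (Real.exp_pos _).le, ← Real.exp_add, ← mul_add, sqDeviation,
            Finset.sum_range_succ, sqDeviation]
      _ = _ := key
      _ = ∫⁻ ω, ENNReal.ofReal (Real.exp (-t * sqDeviation m s q x n ω)) *
            ENNReal.ofReal ((1 + t)⁻¹) ∂P := lintegral_congr fun ω => by
          rw [lintegral_const_mul _ (by fun_prop),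
            lintegral_exp_sq_step m h.sd_pos (h.power_pos n ω) ht]
      _ = _ := by
          rw [lintegral_mul_const' _ _ ENNReal.ofReal_ne_top, ih, ← ENNReal.ofReal_mul (by positivity),
            pow_succ]

end IsGaussianArm

/-! ### Concentration: atypical rounds are summable -/

/-- The slack `n ^ (3 / 4)`. -/
noncomputable def slack (n : ℕ) : ℝ := (√√(n : ℝ)) ^ 3

/-- The event that the statistics of an arm after `n` rounds are close to what is expected. -/
def Typical {Ω : Type*} (m : ℂ) (s ε : ℝ) (q : ℕ → Ω → ℝ) (x : ℕ → Ω → ℂ) (n : ℕ) (ω : Ω) : Prop :=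
  n - slack n ≤ sqDeviation m s q x n ω ∧ sqDeviation m s q x n ω ≤ (1 + ε) * n ∧
    ‖deviation m s q x n ω‖ ^ 2 / (1 + info q n ω) ≤ 3 * Real.log n

lemma sqrt_sqrt_pow_four (n : ℕ) : (√√(n : ℝ)) ^ 4 = n := by
  rw [show (4 : ℕ) = 2 * 2 by norm_num, pow_mul, Real.sq_sqrt (Real.sqrt_nonneg _),
    Real.sq_sqrt (Nat.cast_nonneg _)]

/-- A logarithmic squared deviation times the relative error of the variance estimate is eventually
below one, so that estimating the variance costs only a constant in the exponent. -/
lemma eventually_slack_le (C : ℝ) (hC : 0 ≤ C) : ∀ᶠ n : ℕ in atTop,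
    (1 + C * Real.log n) * (slack n + C * Real.log n) < n := by
  have ht : Tendsto (fun n : ℕ => √√√(n : ℝ)) atTop atTop :=
    Real.tendsto_sqrt_atTop.comp (Real.tendsto_sqrt_atTop.comp
      (Real.tendsto_sqrt_atTop.comp tendsto_natCast_atTop_atTop))
  filter_upwards [ht.eventually_gt_atTop (1 + 16 * C + 64 * C ^ 2),
    ht.eventually_ge_atTop 1, eventually_ge_atTop 1] with n h1 h2 hn
  -- With `r = n ^ (1 / 8)` the slack is `r ^ 6` and the logarithm at most `8 * r`, so the left side
  -- is `O(r ^ 7)`.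
  set r := √√√(n : ℝ) with hr
  have hr2 : r ^ 2 = √√(n : ℝ) := Real.sq_sqrt (Real.sqrt_nonneg _)
  have hr8 : r ^ 8 = n := by
    rw [show (8 : ℕ) = 2 * 4 by norm_num, pow_mul, hr2, sqrt_sqrt_pow_four]
  have hs : slack n = r ^ 6 := by
    rw [slack, ← hr2, ← pow_mul]
  have hlog : Real.log n ≤ 8 * r := by
    rw [← hr8, Real.log_pow]
    have := Real.log_le_sub_one_of_pos (show 0 < r by linarith)
    push_cast
    linarith
  have hlog0 : 0 ≤ Real.log n := Real.log_natCast_nonneg n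
  have hA : C * Real.log n ≤ 8 * C * r := by nlinarith
  have hA0 : 0 ≤ C * Real.log n := mul_nonneg hC hlog0
  have hr1 : r ≤ r ^ 6 := le_self_pow₀ h2 (by norm_num)
  have h6 : 1 ≤ r ^ 6 := one_le_pow₀ h2
  calc (1 + C * Real.log n) * (slack n + C * Real.log n) ≤
      (1 + 8 * C * r) * (r ^ 6 + 8 * C * r) := by rw [hs]; gcongr
    _ ≤ (r + 8 * C * r) * (r ^ 6 + 8 * C * r ^ 6) := by gcongr
    _ = (1 + 16 * C + 64 * C ^ 2) * r ^ 7 := by ring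
    _ < r * r ^ 7 := by gcongr
    _ = n := by rw [← hr8]; ring

/-- Absorbs the prefactor `1 + S` of the mixture into an arbitrarily small exponential rate. -/
lemma one_add_le_mul_exp {c t : ℝ} (hc : 0 < c) (ht : 0 ≤ t) : 1 + t ≤ (1 + c⁻¹) * Real.exp (c * t) := by
  have h1 := Real.add_one_le_exp (c * t)
  have h2 : 0 ≤ c * t := by positivity
  have h3 : t = c⁻¹ * (c * t) := by field_simp
  have h4 : c⁻¹ * (c * t) ≤ c⁻¹ * Real.exp (c * t) := by gcongr; linarith
  nlinarith

lemma measure_le_of_exp {Ω : Type*} [MeasurableSpace Ω] {P : Measure Ω} [IsProbabilityMeasure P] {f : Ω → ℝ} {A : Set Ω} {a b : ℝ}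
    (h : ∫⁻ ω, ENNReal.ofReal (Real.exp (f ω)) ∂P ≤ ENNReal.ofReal b)
    (hA : ∀ ω ∈ A, a ≤ f ω) (hf : Measurable f) : P A ≤ ENNReal.ofReal (Real.exp (-a) * b) := by
  have h1 : ENNReal.ofReal (Real.exp a) * P A ≤ ENNReal.ofReal b := by
    refine le_trans (le_trans (mul_le_mul_right (measure_mono fun ω hω => ?_) _)
      (mul_meas_ge_le_lintegral (by fun_prop) (ENNReal.ofReal (Real.exp a)))) h
    exact ENNReal.ofReal_le_ofReal (Real.exp_le_exp.2 (hA ω hω))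
  rw [ENNReal.ofReal_mul (Real.exp_pos _).le, Real.exp_neg, ENNReal.ofReal_inv_of_pos (Real.exp_pos _)]
  rw [mul_comm, ← div_eq_mul_inv] at *
  rw [ENNReal.le_div_iff_mul_le (Or.inl (by simp [Real.exp_pos])) (Or.inl ENNReal.ofReal_ne_top)]
  exact h1

namespace IsGaussianArm

variable {Ω : Type*} [mΩ : MeasurableSpace Ω] {P : Measure Ω} {ℱ : ℕ → MeasurableSpace Ω} {m : ℂ}
  {s : ℝ} {q : ℕ → Ω → ℝ} {x : ℕ → Ω → ℂ}

/-- Chernoff's bound with parameter `n ^ (-1 / 2)` has exponent `1 / 2 - n ^ (1 / 4)`. The eighth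
Taylor term of `exp` at `n ^ (1 / 4)` is `n ^ 2 / 8!`, whence the stated decay. -/
lemma measure_sqDeviation_lt [IsProbabilityMeasure P] (h : IsGaussianArm P ℱ m s q x) {n : ℕ}
    (hn : 1 ≤ n) : P {ω | sqDeviation m s q x n ω < n - slack n} ≤
      ENNReal.ofReal (Real.exp (1 / 2) * (Nat.factorial 8 : ℝ) * (1 / (n : ℝ) ^ 2)) := by
  set r := √√(n : ℝ) with hr
  have hr4 : r ^ 4 = n := sqrt_sqrt_pow_four n
  have hr0 : 0 < r := Real.sqrt_pos.2 (Real.sqrt_pos.2 (by positivity))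
  set t := (r ^ 2)⁻¹ with ht
  have ht0 : 0 < t := by positivity
  have h1 := measure_le_of_exp (P := P) (f := fun ω => -t * sqDeviation m s q x n ω)
    (A := {ω | sqDeviation m s q x n ω < n - slack n}) (a := -t * (n - slack n))
    (h.lintegral_exp_sqDeviation (t := t) (by linarith) n).le (fun ω hω => by
      have hω : sqDeviation m s q x n ω < n - slack n := hω
      nlinarith) (((h.measurable_sqDeviation n).mono (h.le n) le_rfl).const_mul _)
  refine h1.trans (ENNReal.ofReal_le_ofReal ?_)
  have h2 : (1 + t)⁻¹ ≤ Real.exp (-(t - t ^ 2 / 2)) := by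
    have h3 := Real.le_log_one_add_of_nonneg ht0.le
    have h4 : t - t ^ 2 / 2 ≤ 2 * t / (t + 2) := by
      rw [le_div_iff₀ (by linarith)]
      nlinarith [pow_pos ht0 3]
    rw [Real.exp_neg]
    gcongr
    rw [← Real.le_log_iff_exp_le (by linarith)]
    linarith
  have h5 : Real.exp (-(-t * (n - slack n))) * (1 + t)⁻¹ ^ n ≤ Real.exp (1 / 2) * Real.exp (-r) := by
    calc _ ≤ Real.exp (-(-t * (n - slack n))) * (Real.exp (-(t - t ^ 2 / 2))) ^ n := by gcongr
      _ = Real.exp (1 / 2) * Real.exp (-r) := by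
        rw [← Real.exp_nat_mul, ← Real.exp_add, ← Real.exp_add, slack, ← hr, ← hr4, ht]
        congr 1
        field_simp
        ring
  have h6 := Real.pow_div_factorial_le_exp r hr0.le 8
  have h7 : Real.exp (-r) ≤ (Nat.factorial 8 : ℝ) * (1 / (n : ℝ) ^ 2) := by
    have : (n : ℝ) ^ 2 = r ^ 8 := by rw [← hr4]; ring
    rw [this, Real.exp_neg, mul_one_div, inv_le_comm₀ (Real.exp_pos _) (by positivity), inv_div]
    exact h6
  refine h5.trans ?_
  rw [mul_assoc]
  gcongr

/-- Chernoff's bound for a sum of `n` standard exponentials, at the optimal parameter `ε / (1 + ε)`.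
-/
lemma measure_lt_sqDeviation [IsProbabilityMeasure P] (h : IsGaussianArm P ℱ m s q x) {ε : ℝ}
    (hε : 0 < ε) (n : ℕ) : P {ω | (1 + ε) * n < sqDeviation m s q x n ω} ≤
      ENNReal.ofReal (((1 + ε) * Real.exp (-ε)) ^ n) := by
  have h1 := measure_le_of_exp (P := P) (f := fun ω => -(-(ε / (1 + ε))) * sqDeviation m s q x n ω)
    (A := {ω | (1 + ε) * n < sqDeviation m s q x n ω}) (a := ε * n)
    (h.lintegral_exp_sqDeviation (t := -(ε / (1 + ε))) (by
      rw [neg_lt_neg_iff, div_lt_one (by linarith)]; linarith) n).le (fun ω hω => by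
      have hω : (1 + ε) * n < sqDeviation m s q x n ω := hω
      rw [neg_neg, div_mul_eq_mul_div, le_div_iff₀ (by linarith)]
      nlinarith) (((h.measurable_sqDeviation n).mono (h.le n) le_rfl).const_mul _)
  refine h1.trans (ENNReal.ofReal_le_ofReal (le_of_eq ?_))
  rw [mul_pow, ← Real.exp_nat_mul, mul_comm]
  congr 2
  · field_simp
    ring
  · ring

/-- The information is at most `n`, so the exponential is at most `(1 + n)` times the mixture, which
has mean one; Markov's inequality leaves `(1 + n) / n ^ 3`. -/
lemma measure_lt_deviation [IsProbabilityMeasure P] (h : IsGaussianArm P ℱ m s q x) {n : ℕ}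
    (hn : 1 ≤ n) :
    P {ω | 3 * Real.log n < ‖deviation m s q x n ω‖ ^ 2 / (1 + info q n ω)} ≤
      ENNReal.ofReal (2 * (1 / (n : ℝ) ^ 2)) := by
  have hn' : (1 : ℝ) ≤ n := by exact_mod_cast hn
  have hb : ∫⁻ ω, ENNReal.ofReal (Real.exp (‖deviation m s q x n ω‖ ^ 2 / (1 + info q n ω))) ∂P ≤
      ENNReal.ofReal (1 + n) := by
    calc _ ≤ ∫⁻ ω, ENNReal.ofReal (1 + n) * ENNReal.ofReal (mixture m s q x n ω) ∂P := by
          refine lintegral_mono fun ω => ?_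
          rw [← ENNReal.ofReal_mul (by positivity)]
          refine ENNReal.ofReal_le_ofReal ?_
          have h1 := h.info_nonneg n ω
          have h2 := h.info_le n ω
          rw [mixture, ← mul_assoc]
          refine le_mul_of_one_le_left (Real.exp_pos _).le ?_
          rw [← div_eq_mul_inv, one_le_div (by linarith)]
          linarith
      _ = _ := by rw [lintegral_const_mul' _ _ ENNReal.ofReal_ne_top, h.lintegral_mixture, mul_one]
  have h1 := measure_le_of_exp hb (a := 3 * Real.log n)
    (A := {ω | 3 * Real.log n < ‖deviation m s q x n ω‖ ^ 2 / (1 + info q n ω)})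
    (fun ω hω => le_of_lt hω) (((Measurable.comp (g := fun z : ℂ => ‖z‖ ^ 2) (by fun_prop)
      (h.measurable_deviation n)).div ((h.measurable_info n).const_add 1)).mono (h.le n) le_rfl)
  refine h1.trans (ENNReal.ofReal_le_ofReal ?_)
  have : Real.exp (-(3 * Real.log n)) = ((n : ℝ) ^ 3)⁻¹ := by
    rw [Real.exp_neg, show 3 * Real.log n = Real.log ((n : ℝ) ^ 3) by rw [Real.log_pow]; norm_num,
      Real.exp_log (by positivity)]
  rw [this, mul_one_div, ← div_eq_inv_mul, div_le_div_iff₀ (by positivity) (by positivity)]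
  nlinarith [mul_nonneg (sq_nonneg (n : ℝ)) (sub_nonneg.2 hn')]

lemma exists_summable_not_typical [IsProbabilityMeasure P] (h : IsGaussianArm P ℱ m s q x) {ε : ℝ}
    (hε : 0 < ε) : ∃ b : ℕ → ℝ, (∀ n, 0 ≤ b n) ∧ Summable b ∧
      ∀ n, 1 ≤ n → P {ω | ¬ Typical m s ε q x n ω} ≤ ENNReal.ofReal (b n) := by
  have hsq : Summable fun n : ℕ => 1 / (n : ℝ) ^ 2 := Real.summable_one_div_nat_pow.2 one_lt_two
  have hr0 : 0 ≤ (1 + ε) * Real.exp (-ε) := by positivity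
  have hr1 : (1 + ε) * Real.exp (-ε) < 1 := by
    rw [Real.exp_neg, ← div_eq_mul_inv, div_lt_one (Real.exp_pos _), add_comm]
    exact Real.add_one_lt_exp hε.ne'
  refine ⟨fun n => Real.exp (1 / 2) * (Nat.factorial 8 : ℝ) * (1 / (n : ℝ) ^ 2) +
    ((1 + ε) * Real.exp (-ε)) ^ n + 2 * (1 / (n : ℝ) ^ 2), fun n => by positivity,
    ((hsq.mul_left _).add (summable_geometric_of_lt_one hr0 hr1)).add (hsq.mul_left _),
    fun n hn => ?_⟩
  rw [ENNReal.ofReal_add (by positivity) (by positivity),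
    ENNReal.ofReal_add (by positivity) (by positivity)]
  refine le_trans ?_ (add_le_add (add_le_add (h.measure_sqDeviation_lt hn)
    (h.measure_lt_sqDeviation hε n)) (h.measure_lt_deviation hn))
  refine le_trans (measure_mono ?_) ((measure_union_le _ _).trans
    (add_le_add_left (measure_union_le _ _) _))
  intro ω hω
  simp only [Typical, Set.mem_ofPred_eq, not_and_or, not_le] at hω
  rcases hω with h1 | h1 | h1
  · exact Or.inl (Or.inl h1)
  · exact Or.inl (Or.inr h1)
  · exact Or.inr h1

end IsGaussianArm

/-! ### Student tails against exponentials -/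

lemma one_div_one_add_le_exp {z z' : ℝ} (h0 : 0 ≤ z') (h : z' ≤ z) :
    1 / (1 + z) ≤ Real.exp (-(z' / (1 + z'))) := by
  have h1 : 1 - z' / (1 + z') = 1 / (1 + z') := by field_simp; ring
  calc 1 / (1 + z) ≤ 1 / (1 + z') := by gcongr
    _ = -(z' / (1 + z')) + 1 := by rw [← h1]; ring
    _ ≤ _ := Real.add_one_le_exp _

/-- The Student tail at the critical amount of information. -/
lemma student_tail_le {b L z : ℝ} (hb : 1 < b) (hL : 2 ≤ L) (k : ℕ) (hz : b * L / (k + 3) ≤ z) :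
    (1 / (1 + z)) ^ (k + 1) ≤ Real.exp (-L) + (1 / (1 + (b - 1) / 2)) ^ (k + 1) := by
  have hb' : 0 < b - 1 := by linarith
  have hz0 : 0 ≤ b * L / (k + 3) := by positivity
  -- With many rounds the tail is almost exponential, and the factor `b > 1` pays for `z / (1 + z)`
  -- in place of `z` and for `k + 1` in place of `k + 3`. With few rounds `z` is at least `(b - 1) /
  -- 2`, by `L + 2 ≤ 2 * L`, and the tail decays geometrically.
  by_cases hk : b * (L + 2) ≤ (b - 1) * (k + 3)
  · refine le_trans ?_ (le_add_of_nonneg_right (by positivity))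
    calc (1 / (1 + z)) ^ (k + 1) ≤
          (Real.exp (-((b * L / (k + 3)) / (1 + b * L / (k + 3))))) ^ (k + 1) := by
          gcongr
          · have : 0 ≤ z := hz0.trans hz
            positivity
          · exact one_div_one_add_le_exp hz0 hz
      _ ≤ Real.exp (-L) := by
        rw [← Real.exp_nat_mul, Real.exp_le_exp, mul_neg, neg_le_neg_iff]
        rw [show b * L / ((k : ℝ) + 3) / (1 + b * L / (k + 3)) = b * L / (k + 3 + b * L) by
          field_simp, ← mul_div_assoc, le_div_iff₀ (by positivity)]
        push_cast
        have : L * (k + 3 + b * L) ≤ L * (b * (k + 1)) := by gcongr; linarith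
        linarith
  · push Not at hk
    refine le_trans ?_ (le_add_of_nonneg_left (Real.exp_pos _).le)
    have h1 : (b - 1) / 2 ≤ b * L / (k + 3) := by
      rw [div_le_div_iff₀ two_pos (by positivity)]
      nlinarith
    have h2 : 0 ≤ z := hz0.trans hz
    gcongr
    exact h1.trans hz

/-- As `S ≤ k + 3`, the denominator `V + S * d ^ 2` is at most linear in `k + 3`, and the power `k +
1` leaves a rate linear in `S`; the 3 comes from `k + 3 ≤ 3 * (k + 1)`. -/
lemma student_tail_le_exp {v d S V : ℝ} (hv : 0 < v) (hd : 0 < d) (k : ℕ) (hS : 0 ≤ S)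
    (hSk : S ≤ k + 3) (hV : 0 < V) (hVv : V ≤ v * (k + 3)) :
    (V / (V + S * d ^ 2)) ^ (k + 1) ≤ Real.exp (-(d ^ 2 / (3 * (v + d ^ 2))) * S) := by
  have e : V / (V + S * d ^ 2) = 1 / (1 + S * d ^ 2 / V) := by field_simp
  set z' := S * d ^ 2 / (v * (k + 3)) with hz'
  have h0 : 0 ≤ z' := by positivity
  have h1 : z' ≤ S * d ^ 2 / V := by rw [hz']; gcongr
  rw [e]
  calc _ ≤ (Real.exp (-(z' / (1 + z')))) ^ (k + 1) := by
        gcongr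
        exact one_div_one_add_le_exp h0 h1
    _ ≤ _ := by
      rw [← Real.exp_nat_mul, Real.exp_le_exp, mul_neg, neg_mul, neg_le_neg_iff]
      rw [show z' / (1 + z') = S * d ^ 2 / (v * (k + 3) + S * d ^ 2) by rw [hz']; field_simp,
        ← mul_div_assoc, div_mul_eq_mul_div, div_le_div_iff₀ (by positivity) (by positivity)]
      push_cast
      have h2 : v * (k + 3) + S * d ^ 2 ≤ (v + d ^ 2) * (k + 3) := by nlinarith [sq_nonneg d]
      have h3 : 0 ≤ d ^ 2 * S := by positivity
      calc d ^ 2 * S * (v * (k + 3) + S * d ^ 2) ≤ d ^ 2 * S * ((v + d ^ 2) * (k + 3)) := by gcongr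
        _ ≤ d ^ 2 * S * ((v + d ^ 2) * (3 * (k + 1))) := by gcongr; linarith
        _ = _ := by ring

lemma exp_neg_le_student_tail {X V y : ℝ} (k : ℕ) (hV : 0 < V) (hX : 0 ≤ X)
    (h : X / V * (k + 1) ≤ y) : Real.exp (-y) ≤ (V / (V + X)) ^ (k + 1) := by
  have e : V / (V + X) = (1 + X / V)⁻¹ := by field_simp
  rw [e, inv_pow, Real.exp_neg]
  gcongr
  calc (1 + X / V) ^ (k + 1) ≤ (Real.exp (X / V)) ^ (k + 1) := by
        gcongr
        rw [add_comm]
        exact Real.add_one_le_exp _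
    _ ≤ _ := by
      rw [← Real.exp_nat_mul, Real.exp_le_exp]
      push_cast
      linarith

/-! ### Posterior tails on the typical event -/

section Posterior

variable {Ω : Type*} {m : ℂ} {s : ℝ} {q : ℕ → Ω → ℝ} {x : ℕ → Ω → ℂ}

/-- The empirical mean, in terms of the deviation. -/
noncomputable def empiricalMean (m : ℂ) (s : ℝ) (q : ℕ → Ω → ℝ) (x : ℕ → Ω → ℂ) (n : ℕ) (ω : Ω) : ℂ :=
  m + ((s / info q n ω : ℝ) : ℂ) * deviation m s q x n ω

/-- The empirical weighted sum of squares, in terms of the deviation. -/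
noncomputable def empiricalSq (m : ℂ) (s : ℝ) (q : ℕ → Ω → ℝ) (x : ℕ → Ω → ℂ) (n : ℕ) (ω : Ω) : ℝ :=
  s ^ 2 * (sqDeviation m s q x n ω - ‖deviation m s q x n ω‖ ^ 2 / info q n ω)

lemma norm_empiricalMean_sub (hs : 0 < s) {n : ℕ} {ω : Ω} (hS : 0 < info q n ω) :
    ‖empiricalMean m s q x n ω - m‖ = s * ‖deviation m s q x n ω‖ / info q n ω := by
  rw [empiricalMean, add_sub_cancel_left, norm_mul, Complex.norm_real, Real.norm_eq_abs,
    abs_of_pos (by positivity), div_mul_eq_mul_div]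

lemma sum_sq_eq_empirical (hs : 0 < s) {n : ℕ} {ω : Ω} (hS : 0 < info q n ω) (m' : ℂ) :
    ∑ l ∈ Finset.range n, q l ω * ‖x l ω - m'‖ ^ 2 =
      empiricalSq m s q x n ω + info q n ω * ‖m' - empiricalMean m s q x n ω‖ ^ 2 := by
  have hM : ∑ l ∈ Finset.range n, (q l ω : ℂ) * x l ω =
      ((∑ l ∈ Finset.range n, q l ω : ℝ) : ℂ) * empiricalMean m s q x n ω := by
    have h1 : ((∑ l ∈ Finset.range n, q l ω : ℝ) : ℂ) ≠ 0 := by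
      exact_mod_cast hS.ne'
    have h2 : (s : ℂ) ≠ 0 := by exact_mod_cast hs.ne'
    simp only [empiricalMean, info, deviation, Complex.ofReal_div, mul_add, mul_sub,
      Finset.sum_sub_distrib, div_mul_eq_mul_div, ← Finset.sum_div, ← Finset.sum_mul]
    push_cast at h1 ⊢
    field_simp
    ring
  have h1 := sum_mul_norm_sub_sq (Finset.range n) (fun l => q l ω) (fun l => x l ω) m'
    (empiricalMean m s q x n ω) hM
  have h2 := sum_mul_norm_sub_sq (Finset.range n) (fun l => q l ω) (fun l => x l ω) m
    (empiricalMean m s q x n ω) hM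
  have h3 : ∑ l ∈ Finset.range n, q l ω * ‖x l ω - m‖ ^ 2 = s ^ 2 * sqDeviation m s q x n ω := by
    rw [sqDeviation, ← Finset.sum_div]
    field_simp
  have h4 : info q n ω * ‖m - empiricalMean m s q x n ω‖ ^ 2 =
      s ^ 2 * (‖deviation m s q x n ω‖ ^ 2 / info q n ω) := by
    rw [norm_sub_rev, norm_empiricalMean_sub hs hS]
    field_simp
  have h5 : ∑ l ∈ Finset.range n, q l ω = info q n ω := rfl
  simp only [h3, h5, h4] at h1 h2
  rw [h1, empiricalSq]
  linarith

/-- Where the statistics are typical, the squared deviation is logarithmic. -/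
lemma Typical.deviation_sq_div_le {ε s₀ : ℝ} {n : ℕ} {ω : Ω} (h : Typical m s ε q x n ω)
    (h0 : 0 < s₀) (hS : s₀ ≤ info q n ω) :
    ‖deviation m s q x n ω‖ ^ 2 / info q n ω ≤ (1 + s₀⁻¹) * 3 * Real.log n := by
  have hS' := h0.trans_le hS
  have : ‖deviation m s q x n ω‖ ^ 2 / info q n ω =
      (1 + (info q n ω)⁻¹) * (‖deviation m s q x n ω‖ ^ 2 / (1 + info q n ω)) := by field_simp; ring
  rw [this, mul_assoc]
  gcongr
  exact h.2.2

lemma Typical.empiricalSq_le {ε : ℝ} {n : ℕ} {ω : Ω} (h : Typical m s ε q x n ω)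
    (hS : 0 < info q n ω) : empiricalSq m s q x n ω ≤ s ^ 2 * (1 + ε) * n := by
  rw [empiricalSq, mul_assoc]
  have : 0 ≤ ‖deviation m s q x n ω‖ ^ 2 / info q n ω := by positivity
  gcongr
  linarith [h.2.1]

lemma exp_deviation_eq {n : ℕ} {ω : Ω} (hS : 0 < info q n ω) :
    Real.exp (‖deviation m s q x n ω‖ ^ 2 / (1 + info q n ω)) =
      (1 + info q n ω) * mixture m s q x n ω := by
  rw [mixture, mul_inv_cancel_left₀ (by linarith)]

/-- A large error of the empirical mean makes the mixture martingale large. -/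
lemma one_le_mul_mixture (hs : 0 < s) {η : ℝ} (hη : 0 < η) :
    ∃ c C : ℝ, 0 < c ∧ 0 < C ∧ ∀ n ω, 0 < info q n ω → η < ‖empiricalMean m s q x n ω - m‖ →
      1 ≤ C * (Real.exp (-c * info q n ω) * mixture m s q x n ω) := by
  set e := η / s with he
  have he0 : 0 < e := by positivity
  refine ⟨e ^ 2 / 2, Real.exp (e ^ 2) * (1 + (e ^ 2 / 2)⁻¹), by positivity, by positivity,
    fun n ω hS h => ?_⟩
  rw [norm_empiricalMean_sub hs hS] at h
  set S := info q n ω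
  have hA : e * S ≤ ‖deviation m s q x n ω‖ := by
    rw [lt_div_iff₀ hS] at h
    rw [he, div_mul_eq_mul_div, div_le_iff₀ hs]
    linarith
  -- Uses `S ^ 2 / (1 + S) ≥ S - 1`. Half of the rate `e ^ 2` is then spent on the prefactor `1 +
  -- S`.
  have h1 : e ^ 2 * (S - 1) ≤ ‖deviation m s q x n ω‖ ^ 2 / (1 + S) := by
    rw [le_div_iff₀ (by linarith)]
    have : (e * S) ^ 2 ≤ ‖deviation m s q x n ω‖ ^ 2 := by gcongr
    nlinarith [sq_nonneg e]
  have h2 := Real.exp_le_exp.2 h1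
  rw [exp_deviation_eq hS] at h2
  have hW : 0 ≤ mixture m s q x n ω := by unfold mixture; positivity
  have h3 := one_add_le_mul_exp (c := e ^ 2 / 2) (by positivity) hS.le
  calc 1 = Real.exp (e ^ 2) * Real.exp (-e ^ 2 * S) * Real.exp (e ^ 2 * (S - 1)) := by
        rw [← Real.exp_add, ← Real.exp_add, eq_comm, Real.exp_eq_one_iff]; ring
    _ ≤ Real.exp (e ^ 2) * Real.exp (-e ^ 2 * S) *
          (((1 + (e ^ 2 / 2)⁻¹) * Real.exp (e ^ 2 / 2 * S)) * mixture m s q x n ω) := by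
        gcongr
        exact h2.trans (by gcongr)
    _ = Real.exp (e ^ 2) * (1 + (e ^ 2 / 2)⁻¹) *
          ((Real.exp (-e ^ 2 * S) * Real.exp (e ^ 2 / 2 * S)) * mixture m s q x n ω) := by ring
    _ = _ := by rw [← Real.exp_add]; ring_nf

/-- The second claim says that multiplying an exponent `X ≤ ‖A‖² / S` by the random factor `s² n /
V` adds at most one to it. The lower bound on the squared deviations, with its slack `n ^ (3 / 4)`,
is needed here. -/
lemma eventually_empiricalSq_pos (m : ℂ) (q : ℕ → Ω → ℝ) (x : ℕ → Ω → ℂ) (hs : 0 < s) {s₀ : ℝ}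
    (h0 : 0 < s₀) (ε : ℝ) : ∃ N : ℕ, ∀ n ≥ N, ∀ ω, s₀ ≤ info q n ω → Typical m s ε q x n ω →
      0 < empiricalSq m s q x n ω ∧
      ∀ X, 0 ≤ X → X ≤ ‖deviation m s q x n ω‖ ^ 2 / info q n ω →
        X * n ≤ (X + 1) * (sqDeviation m s q x n ω - ‖deviation m s q x n ω‖ ^ 2 / info q n ω) := by
  set C := (1 + s₀⁻¹) * 3 with hC
  obtain ⟨N, hN⟩ := eventually_atTop.1 (eventually_slack_le C (by positivity))
  refine ⟨N, fun n hn ω hS h => ?_⟩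
  have h1 := hN n hn
  have h2 := h.deviation_sq_div_le h0 hS
  have h3 := h.1
  set U := ‖deviation m s q x n ω‖ ^ 2 / info q n ω with hU
  have hU0 : 0 ≤ U := by
    have := h0.trans_le hS
    positivity
  rw [← hC] at h2
  have hl : 0 ≤ C * Real.log n := mul_nonneg (by positivity) (Real.log_natCast_nonneg n)
  have hsl : 0 ≤ slack n := by unfold slack; positivity
  refine ⟨?_, fun X hX hXU => ?_⟩
  · rw [empiricalSq, ← hU]
    refine mul_pos (by positivity) ?_
    nlinarith
  · have : (1 + X) * (slack n + C * Real.log n) ≤ (1 + C * Real.log n) * (slack n + C * Real.log n) := by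
      gcongr
      exact hXU.trans h2
    have h5 : n - (slack n + C * Real.log n) ≤ sqDeviation m s q x n ω - U := by linarith
    nlinarith

/-- Posterior tail of a suboptimal arm. -/
lemma suboptimal_posterior_le (hs : 0 < s) {ε η y b B L : ℝ} (hε : 0 < ε)
    (hy : ‖m‖ + η < y) (hb : 1 < b) (hL : 2 ≤ L)
    (hB : b * (s ^ 2 * (1 + ε)) ≤ B * (y - ‖m‖ - η) ^ 2) (k : ℕ) (ω : Ω)
    (hq : ∀ l < k + 3, 0 < q l ω) (hS : 0 < info q (k + 3) ω)
    (hV : 0 < empiricalSq m s q x (k + 3) ω) (ht : Typical m s ε q x (k + 3) ω)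
    (hM : ‖empiricalMean m s q x (k + 3) ω - m‖ ≤ η) (hBL : B * L < info q (k + 3) ω) :
    (posterior (k + 3) (fun l => q l ω) (fun l => x l ω)).real {m' | y ≤ ‖m'‖} ≤
      Real.exp (-L) + (1 / (1 + (b - 1) / 2)) ^ (k + 1) := by
  set d := y - ‖m‖ - η with hd
  have hd0 : 0 < d := by linarith
  set S := info q (k + 3) ω
  set V := empiricalSq m s q x (k + 3) ω
  set M := empiricalMean m s q x (k + 3) ω
  have hVle : V ≤ s ^ 2 * (1 + ε) * (k + 3) := by
    have := ht.empiricalSq_le hS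
    push_cast at this
    exact this
  have key : ∀ r, 0 ≤ r → r < d →
      (posterior (k + 3) (fun l => q l ω) (fun l => x l ω)).real {m' | y ≤ ‖m'‖} ≤
      (V / (V + S * r ^ 2)) ^ (k + 1) := fun r hr hrd =>
    posterior_real_le (fun l hl => hq l hl) hV hS (fun m' => sum_sq_eq_empirical hs hS m') hr
      (fun m' hm' => by
        have h1 : y ≤ ‖m'‖ := hm'
        have h2 : ‖m'‖ ≤ ‖m' - M‖ + ‖M - m‖ + ‖m‖ := by
          have := norm_add₃_le (a := m' - M) (b := M - m) (c := m)
          simpa using this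
        linarith)
  -- The tail bound asks for a strict distance, available only for radii below `d`; continuity
  -- allows `r ↑ d`.
  have hlim : (posterior (k + 3) (fun l => q l ω) (fun l => x l ω)).real {m' | y ≤ ‖m'‖} ≤
      (V / (V + S * d ^ 2)) ^ (k + 1) := by
    have hc : ContinuousWithinAt (fun r : ℝ => (V / (V + S * r ^ 2)) ^ (k + 1)) (Set.Iio d) d := by
      refine ContinuousAt.continuousWithinAt ?_
      have : V + S * d ^ 2 ≠ 0 := by positivity
      fun_prop (disch := assumption)
    refine ge_of_tendsto hc ?_
    filter_upwards [Ioo_mem_nhdsLT hd0] with r hr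
    exact key r hr.1.le hr.2
  refine hlim.trans ?_
  rw [show V / (V + S * d ^ 2) = 1 / (1 + S * d ^ 2 / V) by field_simp]
  refine student_tail_le hb hL k ?_
  have hB0 : 0 < B := by
    have : 0 < B * d ^ 2 := lt_of_lt_of_le (by positivity) hB
    exact pos_of_mul_pos_left this (by positivity)
  rw [div_le_div_iff₀ (by positivity) hV]
  calc b * L * V ≤ b * L * (s ^ 2 * (1 + ε) * (k + 3)) := by gcongr
    _ = (b * (s ^ 2 * (1 + ε))) * (L * (k + 3)) := by ring
    _ ≤ (B * d ^ 2) * (L * (k + 3)) := by gcongr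
    _ = (B * L) * (d ^ 2 * (k + 3)) := by ring
    _ ≤ S * (d ^ 2 * (k + 3)) := by gcongr
    _ = _ := by ring

/-- The optimal arm: under the posterior, a small mean is not much more likely than a large one. -/
lemma optimal_posterior_le (hs : 0 < s) {s₀ ε y y' : ℝ} (h0 : 0 < s₀) (hε : 0 < ε) (hy : 0 < y)
    (hyy : y < y') (hy' : y' < ‖m‖) : ∃ c C : ℝ, ∃ N : ℕ, 0 < c ∧ 0 < C ∧ ∀ k : ℕ, N ≤ k + 3 →
      ∀ ω, (∀ l < k + 3, 0 < q l ω) → s₀ ≤ info q (k + 3) ω → info q (k + 3) ω ≤ k + 3 →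
      Typical m s ε q x (k + 3) ω →
      (posterior (k + 3) (fun l => q l ω) (fun l => x l ω)).real {m' | ‖m'‖ < y} ≤
        C * (Real.exp (-c * info q (k + 3) ω) * (1 + mixture m s q x (k + 3) ω)) *
        (posterior (k + 3) (fun l => q l ω) (fun l => x l ω)).real {m' | y ≤ ‖m'‖} := by
  obtain ⟨N, hN⟩ := eventually_empiricalSq_pos m q x hs h0 ε
  -- The opening at which going from `M` into the sector, with `‖M‖ + ρ` at least `y'`, still leaves
  -- a component of at least `y' * cos θ = y` along the axis.
  set θ := Real.arccos (y / y') with hθ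
  have hy'0 : 0 < y' := hy.trans hyy
  have hθ0 : 0 < θ := Real.arccos_pos.2 ((div_lt_one hy'0).2 hyy)
  have hθπ : θ ≤ Real.pi := Real.arccos_le_pi _
  have hcos : Real.cos θ = y / y' := Real.cos_arccos
    (by linarith [div_pos hy hy'0]) ((div_lt_one hy'0).2 hyy).le
  set δ := y' - y with hδ
  have hδ0 : 0 < δ := sub_pos.2 hyy
  set e := (‖m‖ - y') / s with he
  have he0 : 0 < e := div_pos (sub_pos.2 hy') hs
  set D := 2 * ‖m‖ / s with hD
  set v := s ^ 2 * (1 + ε) with hv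
  have hv0 : 0 < v := by positivity
  set c1 := δ ^ 2 / (3 * (v + δ ^ 2)) with hc1
  set c2 := e ^ 2 / 2 with hc2
  have hc1' : 0 < c1 := by positivity
  have hc2' : 0 < c2 := by positivity
  set C2 := Real.exp (1 + D ^ 2) * (1 + c2⁻¹) with hC2
  refine ⟨min c1 c2, Real.pi / θ * (1 + C2), N, lt_min hc1' hc2', by positivity,
    fun k hk ω hq hS hSk ht => ?_⟩
  have hS0 := h0.trans_le hS
  obtain ⟨hV, hX⟩ := hN (k + 3) hk ω hS ht
  have hVle := ht.empiricalSq_le hS0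
  have hVdef : empiricalSq m s q x (k + 3) ω = s ^ 2 * (sqDeviation m s q x (k + 3) ω -
    ‖deviation m s q x (k + 3) ω‖ ^ 2 / info q (k + 3) ω) := rfl
  have hMm := norm_empiricalMean_sub (m := m) (x := x) hs hS0
  have hexp := exp_deviation_eq (m := m) (s := s) (x := x) hS0
  have hsum := fun m' => sum_sq_eq_empirical (m := m) (x := x) hs hS0 m'
  have hW : 0 ≤ mixture m s q x (k + 3) ω := by unfold mixture; positivity
  set S := info q (k + 3) ω
  set V := empiricalSq m s q x (k + 3) ω
  set M := empiricalMean m s q x (k + 3) ω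
  set W := mixture m s q x (k + 3) ω
  set a := ‖deviation m s q x (k + 3) ω‖
  set π' := posterior (k + 3) (fun l => q l ω) (fun l => x l ω)
  have hmeas : MeasurableSet {m' : ℂ | y ≤ ‖m'‖} := measurableSet_le measurable_const measurable_norm
  obtain ⟨u, hu1, hu⟩ : ∃ u : ℂ, ‖u‖ = 1 ∧ M = u * ‖M‖ := by
    by_cases h : M = 0
    · exact ⟨1, by simp, by simp [h]⟩
    · have : ‖M‖ ≠ 0 := norm_ne_zero_iff.2 h
      refine ⟨M / ‖M‖, by simp [this], ?_⟩
      rw [div_mul_cancel₀]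
      exact_mod_cast this
  have hsector : ∀ r, 0 ≤ r → y' ≤ ‖M‖ + r →
      θ / Real.pi * (V / (V + S * r ^ 2)) ^ (k + 1) ≤ π'.real {m' | y ≤ ‖m'‖} := fun r hr hMr => by
    refine le_posterior_real hq hV hS0 hu1 hsum hmeas hr hθ0.le hθπ fun ρ φ hρ hφ => ?_
    have hcosφ : y / y' ≤ Real.cos φ := by
      rw [← hcos, ← Real.cos_abs φ]
      exact Real.cos_le_cos_of_nonneg_of_le_pi (abs_nonneg φ) hθπ hφ.le
    have h1 : M + u * (ρ * (Real.cos φ + Real.sin φ * Complex.I) : ℂ) =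
        u * (‖M‖ + ρ * (Real.cos φ + Real.sin φ * Complex.I)) := by
      rw [mul_add u, ← hu]
    have h2 : (‖M‖ + ρ * (Real.cos φ + Real.sin φ * Complex.I) : ℂ).re = ‖M‖ + ρ * Real.cos φ := by
      simp [Complex.cos_ofReal_re, Complex.sin_ofReal_im]
    show y ≤ ‖_‖
    rw [h1, norm_mul, hu1, one_mul]
    refine le_trans ?_ ((le_abs_self _).trans (Complex.abs_re_le_norm _))
    rw [h2]
    have h3 : y / y' ≤ 1 := ((div_lt_one hy'0).2 hyy).le
    calc y = y / y' * y' := by field_simp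
      _ ≤ y / y' * (‖M‖ + ρ) := by gcongr; linarith
      _ = y / y' * ‖M‖ + ρ * (y / y') := by ring
      _ ≤ 1 * ‖M‖ + ρ * Real.cos φ := by
        have : 0 ≤ ρ := hr.trans hρ.le
        gcongr
      _ = _ := by rw [one_mul]
  have hpost0 : 0 ≤ π'.real {m' | y ≤ ‖m'‖} := measureReal_nonneg
  -- If `‖M‖ ≥ y'`, a full sector lies above level `y`, while the ball below `y` is at distance at
  -- least `δ`; no martingale is needed.
  rcases le_or_gt y' ‖M‖ with hM | hM
  · have h1 := hsector 0 le_rfl (by simpa using hM)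
    rw [zero_pow two_ne_zero, mul_zero, add_zero, div_self hV.ne', one_pow, mul_one] at h1
    have h2 : π'.real {m' | ‖m'‖ < y} ≤ Real.exp (-c1 * S) := by
      refine (posterior_real_le hq hV hS0 hsum hδ0.le fun m' hm' => ?_).trans
        (student_tail_le_exp hv0 hδ0 k hS0.le hSk hV (by push_cast at hVle; exact hVle))
      have h3 : ‖m'‖ < y := hm'
      have h4 := norm_sub_norm_le M m'
      rw [norm_sub_rev] at h4
      linarith
    have h3 : 1 ≤ Real.pi / θ * π'.real {m' | y ≤ ‖m'‖} := by
      calc 1 = Real.pi / θ * (θ / Real.pi) := by field_simp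
        _ ≤ _ := by gcongr
    calc _ ≤ Real.exp (-c1 * S) * 1 := by rw [mul_one]; exact h2
      _ ≤ Real.exp (-min c1 c2 * S) * (Real.pi / θ * π'.real {m' | y ≤ ‖m'‖}) := by
        gcongr
        exact min_le_left _ _
      _ = Real.pi / θ * (1 + 0) * (Real.exp (-min c1 c2 * S) * (1 + 0)) *
          π'.real {m' | y ≤ ‖m'‖} := by ring
      _ ≤ _ := by
        gcongr
        positivity
  -- Here the noise `‖A‖ / S` is at least `r / s + e`. So the cost `S r² / s²` of sampling beyond
  -- `y'` falls short of `‖A‖² / S` by `e² S`, and this surplus yields the decay once `‖A‖² / S` is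
  -- charged to the mixture.
  · set r := y' - ‖M‖ with hr
    have hr0 : 0 < r := sub_pos.2 hM
    have h1 := hsector r hr0.le (by linarith)
    have htri : ‖m‖ ≤ ‖M‖ + s * a / S := by
      rw [← hMm]
      have := norm_sub_norm_le m M
      rw [norm_sub_rev] at this
      linarith
    have htri2 : s * a / S ≤ 2 * ‖m‖ := by
      rw [← hMm]
      have := norm_sub_le M m
      linarith
    have ha0 : 0 ≤ a := norm_nonneg _
    have haS : e ≤ a / S := by
      rw [he, div_le_iff₀ hs]
      have : s * a / S = a / S * s := by ring
      linarith
    have haD : a / S ≤ D := by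
      rw [hD, le_div_iff₀ hs]
      have : s * a / S = a / S * s := by ring
      linarith
    have hrs : r / s ≤ a / S - e := by
      rw [div_le_iff₀ hs, sub_mul, he, div_mul_cancel₀ _ hs.ne']
      have : s * a / S = a / S * s := by ring
      linarith
    have hrs0 : 0 ≤ r / s := by positivity
    set X := S * (r / s) ^ 2 with hXdef
    have hX0 : 0 ≤ X := by positivity
    have hXle : X ≤ a ^ 2 / S - e ^ 2 * S := by
      calc X ≤ S * (a / S - e) ^ 2 := by rw [hXdef]; gcongr
        _ = a ^ 2 / S - e ^ 2 * S - 2 * S * e * (a / S - e) := by field_simp; ring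
        _ ≤ _ := by
          have : 0 ≤ 2 * S * e * (a / S - e) := mul_nonneg (by positivity) (by linarith)
          linarith
    have hX1 := hX X hX0 (hXle.trans (by
      have : 0 ≤ e ^ 2 * S := by positivity
      linarith))
    have hQ : sqDeviation m s q x (k + 3) ω - a ^ 2 / S = V / s ^ 2 := by
      rw [hVdef]; field_simp
    rw [hQ] at hX1
    have h2 : Real.exp (-(X + 1)) ≤ (V / (V + S * r ^ 2)) ^ (k + 1) := by
      refine exp_neg_le_student_tail k hV (by positivity) ?_
      have : S * r ^ 2 / V * (k + 1) ≤ X * (k + 3 : ℕ) / (V / s ^ 2) := by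
        rw [show X * (k + 3 : ℕ) / (V / s ^ 2) = S * r ^ 2 / V * (k + 3 : ℕ) by
          rw [hXdef]; field_simp]
        gcongr
        push_cast
        linarith
      refine this.trans ?_
      rw [div_le_iff₀ (by positivity)]
      exact hX1
    have h3 : Real.exp (X + 1) ≤ C2 * (Real.exp (-c2 * S) * W) := by
      -- Since `a / S ≤ D`, replacing `S` by the regularised `1 + S` costs only the constant `D ^
      -- 2`.
      have h4 : a ^ 2 / S ≤ a ^ 2 / (1 + S) + D ^ 2 := by
        have : a ^ 2 / S = a ^ 2 / (1 + S) + (a / S) ^ 2 * (S / (1 + S)) := by field_simp; ring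
        rw [this]
        gcongr
        calc (a / S) ^ 2 * (S / (1 + S)) ≤ D ^ 2 * 1 := by
              gcongr
              rw [div_le_one (by linarith)]
              linarith
          _ = _ := mul_one _
      have h5 := one_add_le_mul_exp hc2' hS0.le
      calc Real.exp (X + 1) ≤ Real.exp ((1 + D ^ 2) + -e ^ 2 * S + a ^ 2 / (1 + S)) :=
            Real.exp_le_exp.2 (by linarith)
        _ = Real.exp (1 + D ^ 2) * Real.exp (-e ^ 2 * S) * ((1 + S) * W) := by
            rw [Real.exp_add, Real.exp_add, hexp]
        _ ≤ Real.exp (1 + D ^ 2) * Real.exp (-e ^ 2 * S) *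
              (((1 + c2⁻¹) * Real.exp (c2 * S)) * W) := by gcongr
        _ = C2 * ((Real.exp (-e ^ 2 * S) * Real.exp (c2 * S)) * W) := by rw [hC2]; ring
        _ = _ := by
            rw [← Real.exp_add, hc2]
            ring_nf
    have h6 : 1 ≤ Real.exp (X + 1) * (Real.pi / θ * π'.real {m' | y ≤ ‖m'‖}) := by
      calc 1 = Real.exp (X + 1) * (Real.pi / θ * (θ / Real.pi * Real.exp (-(X + 1)))) := by
            rw [Real.exp_neg]; field_simp
        _ ≤ _ := by
          gcongr
          exact le_trans (by gcongr) h1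
    calc π'.real {m' | ‖m'‖ < y} ≤ 1 := posterior_real_le_one _ _ _ _
      _ ≤ Real.exp (X + 1) * (Real.pi / θ * π'.real {m' | y ≤ ‖m'‖}) := h6
      _ ≤ C2 * (Real.exp (-c2 * S) * W) * (Real.pi / θ * π'.real {m' | y ≤ ‖m'‖}) := by gcongr
      _ ≤ (1 + C2) * (Real.exp (-min c1 c2 * S) * (1 + W)) *
          (Real.pi / θ * π'.real {m' | y ≤ ‖m'‖}) := by
        gcongr
        · linarith
        · exact min_le_right _ _
        · linarith
      _ = _ := by ring

end Posterior

/-! ### From the bandit to single arms -/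

section Arms

variable {K : ℕ}

lemma outcomeLaw_apply_coord {μ : Fin K → ℂ} {σ : Fin K → ℝ} (hσ : ∀ k, 0 < σ k) {q : Fin K → ℝ}
    (hq : ∀ k, 0 < q k) (k : Fin K) (C : Set ℂ) :
    outcomeLaw μ σ q ((fun x : Fin K → ℂ => x k) ⁻¹' C) = complexGaussian (μ k) (σ k ^ 2 / q k) C := by
  have h1 : (fun x : Fin K → ℂ => x k) ⁻¹' C =
      Set.pi Set.univ (Function.update (fun _ => Set.univ) k C) := by
    ext x
    simp only [Set.mem_preimage, Set.mem_univ_pi]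
    refine ⟨fun h i => ?_, fun h => by simpa using h k⟩
    by_cases hi : i = k
    · subst hi; simpa using h
    · simp [Function.update_of_ne hi]
  rw [outcomeLaw, h1, Measure.pi_pi, Finset.prod_eq_single k]
  · simp
  · intro i _ hi
    rw [Function.update_of_ne hi, complexGaussian_univ _ (div_pos (pow_pos (hσ i) 2) (hq i))]
  · simp

/-- A nonpositive power, zero included since division by zero is zero, makes the Gaussian factor the
zero measure. -/
lemma power_pos_of_outcomeLaw_univ {μ : Fin K → ℂ} {σ : Fin K → ℝ} {q : Fin K → ℝ}
    (h : (outcomeLaw μ σ q).real Set.univ = 1) (k : Fin K) : 0 < q k := by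
  by_contra hk
  push Not at hk
  have h0 : complexGaussian (μ k) (σ k ^ 2 / q k) = 0 :=
    complexGaussian_of_nonpos _ (div_nonpos_of_nonneg_of_nonpos (sq_nonneg _) hk)
  have : outcomeLaw μ σ q Set.univ = 0 := by
    rw [outcomeLaw, Measure.pi_univ]
    exact Finset.prod_eq_zero (Finset.mem_univ k) (by rw [h0]; simp)
  simp [measureReal_def, this] at h

/-- If `k` wins with a sample below `y`, all samples are below `y`. By independence the factor of
`k'` can be exchanged for that of `{y ≤ ‖m‖}` at the price `R`, and on the new box `k'` wins.
Keeping the power of `k'` as a factor makes the error summable. -/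
lemma posteriorOptimal_le_add {n : ℕ} {q : ℕ → Fin K → ℝ} {x : ℕ → Fin K → ℂ} (k k' : Fin K)
    {y R : ℝ} (h : (posterior n (fun l => q l k') (fun l => x l k')).real {m | ‖m‖ < y} ≤
      R * (posterior n (fun l => q l k') (fun l => x l k')).real {m | y ≤ ‖m‖}) (hR : 0 ≤ R) :
    posteriorOptimal n q x k ≤
      (posterior n (fun l => q l k) (fun l => x l k)).real {m | y ≤ ‖m‖} +
        R * posteriorOptimal n q x k' := by
  set ν : Fin K → Measure ℂ := fun i => posterior n (fun l => q l i) (fun l => x l i) with hν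
  have hle : ∀ i (A : Set ℂ), (ν i).real A ≤ 1 := fun i A => posterior_real_le_one _ _ _ _
  have hpi : ∀ A : Fin K → Set ℂ, (Measure.pi ν).real (Set.pi Set.univ A) = ∏ i, (ν i).real (A i) :=
    fun A => by rw [measureReal_def, Measure.pi_pi, ENNReal.toReal_prod]; rfl
  have h1 : posteriorOptimal n q x k ≤ (Measure.pi ν).real (Set.pi Set.univ
        (Function.update (fun _ => Set.univ) k {m | y ≤ ‖m‖})) +
      (Measure.pi ν).real (Set.pi Set.univ fun _ => {m | ‖m‖ < y}) := by
    refine (measureReal_mono ?_).trans (measureReal_union_le _ _)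
    intro m hm
    have hm : ∀ i, ‖m i‖ ≤ ‖m k‖ := hm
    by_cases hk : y ≤ ‖m k‖
    · left
      intro i _
      by_cases hi : i = k
      · subst hi; simpa using hk
      · simp [Function.update_of_ne hi]
    · right
      intro i _
      exact (hm i).trans_lt (not_le.1 hk)
  have h2 : (Measure.pi ν).real (Set.pi Set.univ
      (Function.update (fun _ => Set.univ) k {m | y ≤ ‖m‖})) ≤ (ν k).real {m | y ≤ ‖m‖} := by
    rw [hpi, ← Finset.mul_prod_erase _ _ (Finset.mem_univ k), Function.update_self]
    exact mul_le_of_le_one_right measureReal_nonneg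
      (Finset.prod_le_one (fun _ _ => measureReal_nonneg) fun i _ => hle i _)
  have h3 : (Measure.pi ν).real (Set.pi Set.univ fun _ => {m | ‖m‖ < y}) ≤
      R * posteriorOptimal n q x k' := by
    have h4 : (Measure.pi ν).real (Set.pi Set.univ
        (Function.update (fun _ => {m | ‖m‖ < y}) k' {m | y ≤ ‖m‖})) ≤ posteriorOptimal n q x k' := by
      refine measureReal_mono fun m hm => ?_
      have hk' : y ≤ ‖m k'‖ := by simpa using hm k' (Set.mem_univ _)
      intro i
      by_cases hi : i = k'
      · rw [hi]
      · have : ‖m i‖ < y := by simpa [Function.update_of_ne hi] using hm i (Set.mem_univ _)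
        exact this.le.trans hk'
    refine le_trans ?_ (mul_le_mul_of_nonneg_left h4 hR)
    have h5 : ∏ i ∈ Finset.univ.erase k',
        (ν i).real (Function.update (fun _ => {m : ℂ | ‖m‖ < y}) k' {m | y ≤ ‖m‖} i) =
        ∏ i ∈ Finset.univ.erase k', (ν i).real {m | ‖m‖ < y} :=
      Finset.prod_congr rfl fun i hi => by rw [Function.update_of_ne (Finset.ne_of_mem_erase hi)]
    rw [hpi, hpi, ← Finset.mul_prod_erase _ _ (Finset.mem_univ k'),
      ← Finset.mul_prod_erase _ _ (Finset.mem_univ k'), Function.update_self, h5, ← mul_assoc]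
    exact mul_le_mul_of_nonneg_right h (Finset.prod_nonneg fun _ _ => measureReal_nonneg)
  linarith

lemma posteriorOptimal_le_one (n : ℕ) (q : ℕ → Fin K → ℝ) (x : ℕ → Fin K → ℂ) (k : Fin K) :
    posteriorOptimal n q x k ≤ 1 := by
  refine (measureReal_mono (Set.subset_univ _)).trans ?_
  rw [measureReal_def, Measure.pi_univ, ENNReal.toReal_prod]
  exact Finset.prod_le_one (fun _ _ => ENNReal.toReal_nonneg) fun i _ =>
    posterior_real_le_one _ _ _ _

variable {Ω : Type*} {p : ℕ → Ω → Fin K → ℝ} {X : ℕ → Ω → Fin K → ℂ}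

lemma IsWTS.le_one (h : IsWTS p X) (n : ℕ) (ω : Ω) (k : Fin K) : p n ω k ≤ 1 := by
  rcases lt_or_ge n 3 with hn | hn
  · rcases lt_or_ge n 2 with hn2 | hn2
    · rw [h.initial n hn2]
      have : (1 : ℝ) ≤ K := by exact_mod_cast k.pos
      exact div_le_one_of_le₀ this (by positivity)
    · obtain rfl : n = 2 := by omega
      rw [← h.third_sum ω]
      exact Finset.single_le_sum (fun i _ => (h.third_pos ω i).le) (Finset.mem_univ k)
  · rw [h.step n hn]
    exact posteriorOptimal_le_one _ _ _ _

lemma past_mono (X : ℕ → Ω → Fin K → ℂ) : Monotone (past X) := fun _ _ hnm =>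
  iSup_le fun l => le_iSup_of_le (Fin.castLE hnm l) le_rfl

lemma measurable_past (X : ℕ → Ω → Fin K → ℂ) (n : ℕ) : Measurable[past X (n + 1)] (X n) := by
  have h : Measurable[MeasurableSpace.comap (X n) inferInstance] (X n) := comap_measurable (X n)
  exact h.mono (le_iSup_of_le (Fin.last n) le_rfl) le_rfl

variable [mΩ : MeasurableSpace Ω] {P : Measure Ω} {μ : Fin K → ℂ} {σ : Fin K → ℝ}

lemma IsOutcome.past_le (h : IsOutcome P μ σ p X) (n : ℕ) : past X n ≤ mΩ :=
  iSup_le fun l => (h.measurable l).comap_le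

lemma IsOutcome.ae_pos [IsProbabilityMeasure P] (h : IsOutcome P μ σ p X) :
    ∀ᵐ ω ∂P, ∀ n k, 0 < p n ω k := by
  rw [ae_all_iff]
  intro n
  have h1 := h.condLaw n Set.univ MeasurableSet.univ
  have h2 : P⟦X n ⁻¹' Set.univ | past X n⟧ = fun _ => (1 : ℝ) := by
    rw [Set.preimage_univ, Set.indicator_univ]
    exact condExp_const (h.past_le n) (1 : ℝ)
  filter_upwards [h1] with ω hω k
  rw [h2] at hω
  exact power_pos_of_outcomeLaw_univ hω.symm k

/-- The powers have versions which are measurable with respect to the past. -/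
lemma IsOutcome.exists_measurable_power [IsProbabilityMeasure P] (h : IsOutcome P μ σ p X)
    (hσ : ∀ k, 0 < σ k) (hp : ∀ n ω k, p n ω k ≤ 1) (k : Fin K) :
    ∃ q : ℕ → Ω → ℝ, (∀ n, Measurable[past X n] (q n)) ∧ (∀ n ω, 0 < q n ω) ∧ (∀ n ω, q n ω ≤ 1) ∧
      ∀ᵐ ω ∂P, ∀ n, q n ω = p n ω k := by
  set A : Set (Fin K → ℂ) := (fun x => x k) ⁻¹' {z | 1 < ‖z - μ k‖} with hA
  have hAm : MeasurableSet A := (measurable_pi_apply k)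
    (measurableSet_lt measurable_const (by fun_prop))
  -- The conditional probability of `A` is `exp(-p / σ²)`. Solving for the power gives measurability
  -- without studying how the posterior depends on the data.
  set f : ℕ → Ω → ℝ := fun n ω => -(σ k ^ 2 * Real.log ((P⟦X n ⁻¹' A | past X n⟧) ω)) with hf
  have hfm : ∀ n, Measurable[past X n] (f n) := fun n => by
    have h1 : Measurable[past X n] (P⟦X n ⁻¹' A | past X n⟧) := stronglyMeasurable_condExp.measurable
    exact Measurable.comp (g := fun t : ℝ => -(σ k ^ 2 * Real.log t)) (by fun_prop) h1
  -- The default value 1 makes the bounds hold everywhere, not just almost surely.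
  refine ⟨fun n ω => if f n ω ∈ Set.Ioc 0 1 then f n ω else 1, fun n => ?_, fun n ω => ?_,
    fun n ω => ?_, ?_⟩
  · exact Measurable.ite (hfm n measurableSet_Ioc) (hfm n) measurable_const
  · dsimp only
    split_ifs with hh
    · exact hh.1
    · exact one_pos
  · dsimp only
    split_ifs with hh
    · exact hh.2
    · exact le_rfl
  · have h1 : ∀ᵐ ω ∂P, ∀ n, (P⟦X n ⁻¹' A | past X n⟧) ω = (outcomeLaw μ σ (p n ω)).real A :=
      ae_all_iff.2 fun n => h.condLaw n A hAm
    filter_upwards [h1, h.ae_pos] with ω h1 h2 n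
    have h3 : f n ω = p n ω k := by
      have hpk := h2 n k
      have hσk := hσ k
      rw [hf]
      dsimp only
      rw [h1 n, measureReal_def, hA, outcomeLaw_apply_coord hσ (h2 n) k,
        complexGaussian_compl_ball _ (by positivity), ENNReal.toReal_ofReal (Real.exp_pos _).le,
        Real.log_exp]
      field_simp
    rw [if_pos, h3]
    rw [h3]
    exact ⟨h2 n k, hp n ω k⟩

lemma IsOutcome.isGaussianArm [IsProbabilityMeasure P] (h : IsOutcome P μ σ p X)
    (hσ : ∀ k, 0 < σ k) (k : Fin K) {q : ℕ → Ω → ℝ} (hq : ∀ n, Measurable[past X n] (q n))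
    (hq0 : ∀ n ω, 0 < q n ω) (hq1 : ∀ n ω, q n ω ≤ 1) (hqp : ∀ᵐ ω ∂P, ∀ n, q n ω = p n ω k) :
    IsGaussianArm P (past X) (μ k) (σ k) q fun n ω => X n ω k where
  sd_pos := hσ k
  le := h.past_le
  mono := past_mono X
  measurable_power := hq
  power_pos := hq0
  power_le := hq1
  measurable_outcome n := (measurable_pi_apply k).comp (measurable_past X n)
  law n B C hB hC := by
    set A : Set (Fin K → ℂ) := (fun x => x k) ⁻¹' C with hA
    have hAm : MeasurableSet A := (measurable_pi_apply k) hC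
    have hXA : MeasurableSet (X n ⁻¹' A) := h.measurable n hAm
    have hB' : MeasurableSet B := h.past_le n B hB
    have hint : Integrable ((X n ⁻¹' A).indicator fun _ => (1 : ℝ)) P :=
      (integrable_const 1).indicator hXA
    have h1 : ∫ ω in B, (P⟦X n ⁻¹' A | past X n⟧) ω ∂P = P.real (B ∩ X n ⁻¹' A) := by
      rw [setIntegral_condExp (h.past_le n) hint hB, integral_indicator_const _ hXA, smul_eq_mul,
        mul_one, measureReal_restrict_apply hXA, Set.inter_comm]
    have h2 : ∀ᵐ ω ∂P, ENNReal.ofReal ((P⟦X n ⁻¹' A | past X n⟧) ω) =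
        complexGaussian (μ k) (σ k ^ 2 / q n ω) C := by
      filter_upwards [h.condLaw n A hAm, h.ae_pos, hqp] with ω h3 h4 h5
      have h6 := complexGaussian_univ (μ k) (div_pos (pow_pos (hσ k) 2) (hq0 n ω))
      rw [h3, measureReal_def, hA, outcomeLaw_apply_coord hσ (h4 n) k, ← h5 n, ENNReal.ofReal_toReal]
      exact ((measure_mono (Set.subset_univ C)).trans_lt (h6 ▸ ENNReal.one_lt_top)).ne
    have h3 : 0 ≤ᵐ[P] P⟦X n ⁻¹' A | past X n⟧ :=
      condExp_nonneg (ae_of_all _ fun ω => Set.indicator_nonneg (fun _ _ => zero_le_one) ω)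
    calc P (B ∩ X n ⁻¹' A) = ENNReal.ofReal (P.real (B ∩ X n ⁻¹' A)) := by
          rw [measureReal_def, ENNReal.ofReal_toReal (measure_ne_top _ _)]
      _ = ∫⁻ ω in B, ENNReal.ofReal ((P⟦X n ⁻¹' A | past X n⟧) ω) ∂P := by
          rw [← h1, ofReal_integral_eq_lintegral_ofReal integrable_condExp.integrableOn
            (ae_restrict_of_ae h3)]
      _ = _ := lintegral_congr_ae (ae_restrict_of_ae h2)

end Arms

/-! ### Total power of a suboptimal arm and the regret -/

lemma sum_ite_le {q : ℕ → ℝ} (h0 : ∀ n, 0 ≤ q n) (h1 : ∀ n, q n ≤ 1) {c : ℝ} (hc : 0 ≤ c) (T : ℕ) :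
    ∑ n ∈ Finset.range T, (if ∑ l ∈ Finset.range n, q l ≤ c then q n else 0) ≤ c + 1 := by
  -- The minimum makes the induction work: a round is counted only while the full sum is at most
  -- `c`, and the last such round adds at most 1.
  suffices h : ∑ n ∈ Finset.range T, (if ∑ l ∈ Finset.range n, q l ≤ c then q n else 0) ≤
      min (∑ l ∈ Finset.range T, q l) (c + 1) from h.trans (min_le_right _ _)
  induction T with
  | zero => simp; linarith
  | succ T ih =>
    rw [Finset.sum_range_succ, Finset.sum_range_succ]
    have h2 := h0 T
    have h3 := h1 T
    have h4 := le_min_iff.1 ih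
    split_ifs with h
    · exact le_min (by linarith) (by linarith)
    · exact le_min (by linarith) (by linarith)

/-- The parameters of the comparison can be chosen such that the leading constant is as close to
`s ^ 2 / Δ ^ 2` as desired. -/
lemma exists_parameter {s Δ B : ℝ} (hΔ : 0 < Δ) (hB : s ^ 2 / Δ ^ 2 < B) :
    ∃ τ : ℝ, 0 < τ ∧ 2 * τ < Δ ∧ (1 + τ) * (s ^ 2 * (1 + τ)) ≤ B * (Δ - 2 * τ) ^ 2 := by
  have h1 : (1 + 0) * (s ^ 2 * (1 + 0)) < B * (Δ - 2 * 0) ^ 2 := by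
    rw [div_lt_iff₀ (by positivity)] at hB
    simpa using hB
  have h2 : ∀ᶠ τ : ℝ in nhds 0, (1 + τ) * (s ^ 2 * (1 + τ)) < B * (Δ - 2 * τ) ^ 2 :=
    ContinuousAt.eventually_lt (by fun_prop) (by fun_prop) h1
  have h3 : ∀ᶠ τ : ℝ in nhds 0, 2 * τ < Δ :=
    ContinuousAt.eventually_lt (by fun_prop) (by fun_prop) (by simpa using hΔ)
  obtain ⟨τ, ⟨h4, h5⟩, h6⟩ := (((h2.and h3).filter_mono nhdsWithin_le_nhds).and
    (self_mem_nhdsWithin (s := Set.Ioi (0 : ℝ)))).exists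
  exact ⟨τ, h6, h5, h4.le⟩

variable {Ω : Type*} [mΩ : MeasurableSpace Ω] {P : Measure Ω}
  {K : ℕ} {μ : Fin K → ℂ} {σ : Fin K → ℝ} {p : ℕ → Ω → Fin K → ℝ} {X : ℕ → Ω → Fin K → ℂ}

lemma IsGaussianArm.measurableSet_typical {ℱ : ℕ → MeasurableSpace Ω} {m : ℂ}
    {s : ℝ} {q : ℕ → Ω → ℝ} {x : ℕ → Ω → ℂ} (h : IsGaussianArm P ℱ m s q x) (ε : ℝ) (n : ℕ) :
    MeasurableSet {ω | Typical m s ε q x n ω} := by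
  have h1 := (h.measurable_sqDeviation n).mono (h.le n) le_rfl
  have h2 := (h.measurable_deviation n).mono (h.le n) le_rfl
  have h3 := (h.measurable_info n).mono (h.le n) le_rfl
  exact (measurableSet_le measurable_const h1).inter ((measurableSet_le h1 measurable_const).inter
    (measurableSet_le ((h2.norm.pow_const 2).div (h3.const_add 1)) measurable_const))

/-- Expected power of a suboptimal arm: the crucial pathwise comparison. -/
lemma ae_power_le (hσ : ∀ k, 0 < σ k) (hp : IsWTS p X)
    {k k' : Fin K} {B τ : ℝ} (hτ : 0 < τ) (hτ2 : 2 * τ < ‖μ k'‖ - ‖μ k‖)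
    (hB : (1 + τ) * (σ k ^ 2 * (1 + τ)) ≤ B * (‖μ k'‖ - ‖μ k‖ - 2 * τ) ^ 2)
    {q q' : ℕ → Ω → ℝ} (hq : IsGaussianArm P (past X) (μ k) (σ k) q fun n ω => X n ω k)
    (hq' : IsGaussianArm P (past X) (μ k') (σ k') q' fun n ω => X n ω k')
    (hqp : ∀ᵐ ω ∂P, ∀ n, q n ω = p n ω k) (hqp' : ∀ᵐ ω ∂P, ∀ n, q' n ω = p n ω k') :
    ∃ c c' C C' : ℝ, ∃ N : ℕ, 0 < c ∧ 0 < c' ∧ 0 < C ∧ 0 < C' ∧ ∀ᵐ ω ∂P, ∀ L, 2 ≤ L → ∀ n, N ≤ n →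
      p n ω k ≤
        {ω | ¬ Typical (μ k) (σ k) τ q (fun n ω => X n ω k) n ω}.indicator (fun _ => (1 : ℝ)) ω +
        {ω | ¬ Typical (μ k') (σ k') τ q' (fun n ω => X n ω k') n ω}.indicator (fun _ => (1 : ℝ)) ω +
        C * (q n ω * Real.exp (-c * info q n ω) *
          mixture (μ k) (σ k) q (fun n ω => X n ω k) n ω) +
        C' * (q' n ω * Real.exp (-c' * info q' n ω) *
          mixture (μ k') (σ k') q' (fun n ω => X n ω k') n ω) +
        (C' * (q' n ω * Real.exp (-c' * info q' n ω)) +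
        (if info q n ω ≤ B * L then q n ω else 0) +
        (Real.exp (-L) + C' * (1 / (1 + τ / 2)) ^ n)) := by
  have hK : 0 < K := k.pos
  have hs0 : (0 : ℝ) < 1 / K := by positivity
  obtain ⟨c, C, hc, hC, h1⟩ := one_le_mul_mixture (m := μ k) (q := q) (x := fun n ω => X n ω k)
    (hσ k) hτ
  obtain ⟨N1, h2⟩ := eventually_empiricalSq_pos (μ k) q (fun n ω => X n ω k) (hσ k) hs0 τ
  have hμ0 := norm_nonneg (μ k)
  -- The gap loses `2 * τ`: one `τ` for the level `y` below the better norm, one for the error of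
  -- the empirical mean.
  obtain ⟨c', C', N2, hc', hC', h3⟩ := optimal_posterior_le (m := μ k') (q := q')
    (x := fun n ω => X n ω k') (hσ k') (s₀ := 1 / K) (ε := τ) (y := ‖μ k'‖ - τ)
    (y' := ‖μ k'‖ - τ / 2) hs0 hτ (by linarith) (by linarith) (by linarith)
  set ρ := 1 / (1 + τ / 2) with hρ
  have hρ0 : 0 < ρ := by positivity
  -- The term `(ρ ^ 2)⁻¹` turns the Student exponent `n - 2` into `n`; the 3 is where posterior
  -- sampling starts.
  refine ⟨c, c', C, C' + (ρ ^ 2)⁻¹, max 3 (max N1 N2), hc, hc', hC, by positivity, ?_⟩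
  filter_upwards [hqp, hqp'] with ω h4 h5 L hL n hn
  obtain ⟨j, rfl⟩ : ∃ j, n = j + 3 := ⟨n - 3, by omega⟩
  have hn1 : N1 ≤ j + 3 := by omega
  have hn2 : N2 ≤ j + 3 := by omega
  -- The uniform first round alone bounds the information away from zero.
  have hinfo : 1 / (K : ℝ) ≤ info q (j + 3) ω := by
    rw [← hp.initial 0 two_pos ω k, ← h4 0]
    exact Finset.single_le_sum (f := fun l => q l ω) (fun l _ => (hq.power_pos l ω).le)
      (Finset.mem_range.2 (by omega))
  have hinfo' : 1 / (K : ℝ) ≤ info q' (j + 3) ω := by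
    rw [← hp.initial 0 two_pos ω k', ← h5 0]
    exact Finset.single_le_sum (f := fun l => q' l ω) (fun l _ => (hq'.power_pos l ω).le)
      (Finset.mem_range.2 (by omega))
  have hq0 := (hq.power_pos (j + 3) ω).le
  have hq'0 := (hq'.power_pos (j + 3) ω).le
  have hW := hq.mixture_nonneg (j + 3) ω
  have hW' := hq'.mixture_nonneg (j + 3) ω
  have hi1 : ∀ A : Set Ω, 0 ≤ A.indicator (fun _ => (1 : ℝ)) ω := fun A =>
    Set.indicator_nonneg (fun _ _ => zero_le_one) _
  have t1 := hi1 {ω | ¬ Typical (μ k) (σ k) τ q (fun n ω => X n ω k) (j + 3) ω}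
  have t2 := hi1 {ω | ¬ Typical (μ k') (σ k') τ q' (fun n ω => X n ω k') (j + 3) ω}
  have t3 : 0 ≤ q (j + 3) ω * Real.exp (-c * info q (j + 3) ω) *
    mixture (μ k) (σ k) q (fun n ω => X n ω k) (j + 3) ω := by positivity
  have t4 : 0 ≤ q' (j + 3) ω * Real.exp (-c' * info q' (j + 3) ω) *
    mixture (μ k') (σ k') q' (fun n ω => X n ω k') (j + 3) ω := by positivity
  have t5 : 0 ≤ q' (j + 3) ω * Real.exp (-c' * info q' (j + 3) ω) := by positivity
  have t6 : (0 : ℝ) ≤ if info q (j + 3) ω ≤ B * L then q (j + 3) ω else 0 := by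
    split_ifs
    · exact hq0
    · exact le_rfl
  have t7 : 0 ≤ ρ ^ (j + 3) := by positivity
  have t8 := (Real.exp_pos (-L)).le
  have hρ2 : 0 ≤ (ρ ^ 2)⁻¹ := by positivity
  have t3' := mul_nonneg hC.le t3
  have t4' := mul_nonneg hC'.le t4
  have t5' := mul_nonneg hC'.le t5
  have t7' := mul_nonneg hC'.le t7
  have t4'' := mul_nonneg hρ2 t4
  have t5'' := mul_nonneg hρ2 t5
  have t7'' := mul_nonneg hρ2 t7
  simp only [add_mul]
  by_cases hT : Typical (μ k) (σ k) τ q (fun n ω => X n ω k) (j + 3) ω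
  swap
  · have : {ω | ¬ Typical (μ k) (σ k) τ q (fun n ω => X n ω k) (j + 3) ω}.indicator
      (fun _ => (1 : ℝ)) ω = 1 := Set.indicator_of_mem hT _
    linarith [hp.le_one (j + 3) ω k]
  by_cases hT' : Typical (μ k') (σ k') τ q' (fun n ω => X n ω k') (j + 3) ω
  swap
  · have : {ω | ¬ Typical (μ k') (σ k') τ q' (fun n ω => X n ω k') (j + 3) ω}.indicator
      (fun _ => (1 : ℝ)) ω = 1 := Set.indicator_of_mem hT' _
    linarith [hp.le_one (j + 3) ω k]
  by_cases hM : ‖empiricalMean (μ k) (σ k) q (fun n ω => X n ω k) (j + 3) ω - μ k‖ ≤ τ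
  swap
  -- The inequality `1 ≤ C e^(-cS) W` is multiplied by the power itself, which supplies the factor
  -- `q n` needed for summation.
  · have h6 := h1 (j + 3) ω (hs0.trans_le hinfo) (not_le.1 hM)
    have h7 := mul_le_mul_of_nonneg_left h6 hq0
    rw [mul_one, h4] at h7
    rw [h4] at t6 ⊢
    have : p (j + 3) ω k * (C * (Real.exp (-c * info q (j + 3) ω) *
      mixture (μ k) (σ k) q (fun n ω => X n ω k) (j + 3) ω)) = C * (p (j + 3) ω k *
        Real.exp (-c * info q (j + 3) ω) *
        mixture (μ k) (σ k) q (fun n ω => X n ω k) (j + 3) ω) := by ring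
    rw [h4] at t3 t3'
    linarith
  by_cases hI : info q (j + 3) ω ≤ B * L
  · rw [if_pos hI] at t6 ⊢
    have := h4 (j + 3)
    linarith
  · have h6 := suboptimal_posterior_le (hσ k) (y := ‖μ k'‖ - τ) hτ (by linarith)
      (b := 1 + τ) (by linarith) hL (B := B) (by convert hB using 3; ring) j ω
      (fun l _ => hq.power_pos l ω)
      (hs0.trans_le hinfo) (h2 (j + 3) hn1 ω hinfo hT).1 hT hM (not_le.1 hI)
    have h7 := h3 j hn2 ω (fun l _ => hq'.power_pos l ω) hinfo'
      (by exact_mod_cast hq'.info_le (j + 3) ω) hT'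
    have e1 : (fun l => q l ω) = fun l => p l ω k := funext fun l => h4 l
    have e2 : (fun l => q' l ω) = fun l => p l ω k' := funext fun l => h5 l
    rw [e1] at h6
    rw [e2] at h7
    have h8 := posteriorOptimal_le_add (n := j + 3) (q := fun l => p l ω) (x := fun l => X l ω) k k'
      h7 (by positivity)
    rw [← hp.step (j + 3) (by omega), ← hp.step (j + 3) (by omega), ← h5] at h8
    have h9 : (1 / (1 + (1 + τ - 1) / 2)) ^ (j + 1) = (ρ ^ 2)⁻¹ * ρ ^ (j + 3) := by
      rw [hρ, add_sub_cancel_left, show j + 3 = 2 + (j + 1) by ring, pow_add _ 2,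
        inv_mul_cancel_left₀ (by positivity)]
    rw [h9] at h6
    have h10 : C' * (Real.exp (-c' * info q' (j + 3) ω) * (1 + mixture (μ k') (σ k') q'
        (fun n ω => X n ω k') (j + 3) ω)) * q' (j + 3) ω =
        C' * (q' (j + 3) ω * Real.exp (-c' * info q' (j + 3) ω)) +
        C' * (q' (j + 3) ω * Real.exp (-c' * info q' (j + 3) ω) *
          mixture (μ k') (σ k') q' (fun n ω => X n ω k') (j + 3) ω) := by ring
    linarith

/-- Expected total power of a suboptimal arm. -/
lemma exists_lintegral_power_le [IsProbabilityMeasure P] (hσ : ∀ k, 0 < σ k) (hX : IsOutcome P μ σ p X) (hp : IsWTS p X)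
    {k k' : Fin K} (hk : ‖μ k‖ < ‖μ k'‖) {B : ℝ} (hB : σ k ^ 2 / (‖μ k'‖ - ‖μ k‖) ^ 2 < B) :
    ∃ D : ℝ, ∀ T : ℕ, 2 ≤ Real.log T →
      ∫⁻ ω, ENNReal.ofReal (∑ n ∈ Finset.range T, p n ω k) ∂P ≤
        ENNReal.ofReal (B * Real.log T + D) := by
  obtain ⟨τ, hτ, hτ2, hBτ⟩ := exists_parameter (sub_pos.2 hk) hB
  obtain ⟨q, hqm, hq0, hq1, hqp⟩ := hX.exists_measurable_power hσ hp.le_one k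
  obtain ⟨q', hqm', hq0', hq1', hqp'⟩ := hX.exists_measurable_power hσ hp.le_one k'
  have hq := hX.isGaussianArm hσ k hqm hq0 hq1 hqp
  have hq' := hX.isGaussianArm hσ k' hqm' hq0' hq1' hqp'
  obtain ⟨c, c', C, C', N, hc, hc', hC, hC', hpath⟩ :=
    ae_power_le hσ hp hτ hτ2 hBτ hq hq' hqp hqp'
  obtain ⟨b, hb0, hbs, hb⟩ := hq.exists_summable_not_typical hτ
  obtain ⟨b', hb0', hbs', hb'⟩ := hq'.exists_summable_not_typical hτ
  set ρ := 1 / (1 + τ / 2) with hρ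
  have hρ0 : 0 ≤ ρ := by positivity
  have hρ1 : ρ < 1 := by rw [hρ, div_lt_one (by positivity)]; linarith
  have hB0 : 0 ≤ B := le_trans (by positivity) hB.le
  set E := (1 - Real.exp (-c))⁻¹ with hE
  set E' := (1 - Real.exp (-c'))⁻¹ with hE'
  have hEpos : ∀ {t : ℝ}, 0 < t → 0 ≤ (1 - Real.exp (-t))⁻¹ := fun {t} ht => by
    have : Real.exp (-t) < 1 := by rw [Real.exp_lt_one_iff]; linarith
    exact inv_nonneg.2 (by linarith)
  have hE0 : 0 ≤ E := hEpos hc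
  have hE'0 : 0 ≤ E' := hEpos hc'
  -- The summand `N + 1` pays for the early rounds; index 0 is among them, as the concentration
  -- bounds start at 1.
  set D0 := (N : ℝ) + 1 + (C' * E' + 1 + (1 + C' * (1 - ρ)⁻¹)) with hD0
  have hD0pos : 0 ≤ D0 := by
    have : 0 ≤ (1 - ρ)⁻¹ := inv_nonneg.2 (by linarith)
    positivity
  have hbt : 0 ≤ ∑' n, b n := tsum_nonneg hb0
  have hbt' : 0 ≤ ∑' n, b' n := tsum_nonneg hb0'
  refine ⟨D0 + (∑' n, b n + ∑' n, b' n + C * E + C' * E'), fun T hT => ?_⟩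
  -- With this choice `T` copies of `exp(-L)` add up to one.
  set L := Real.log T with hL
  have hTpos : (0 : ℝ) < T := by
    rcases Nat.eq_zero_or_pos T with h | h
    · rw [hL, h] at hT; norm_num at hT
    · exact_mod_cast h
  set I1 : ℕ → Ω → ℝ := fun n => {ω | ¬ Typical (μ k) (σ k) τ q (fun n ω => X n ω k) n ω}.indicator
    (fun _ => (1 : ℝ)) with hI1
  set I2 : ℕ → Ω → ℝ := fun n =>
    {ω | ¬ Typical (μ k') (σ k') τ q' (fun n ω => X n ω k') n ω}.indicator (fun _ => (1 : ℝ)) with hI2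
  set G1 : ℕ → Ω → ℝ := fun n ω => q n ω * Real.exp (-c * info q n ω) *
    mixture (μ k) (σ k) q (fun n ω => X n ω k) n ω with hG1
  set G2 : ℕ → Ω → ℝ := fun n ω => q' n ω * Real.exp (-c' * info q' n ω) *
    mixture (μ k') (σ k') q' (fun n ω => X n ω k') n ω with hG2
  have hI1pos : ∀ n ω, 0 ≤ I1 n ω := fun n ω => Set.indicator_nonneg (fun _ _ => zero_le_one) _
  have hI2pos : ∀ n ω, 0 ≤ I2 n ω := fun n ω => Set.indicator_nonneg (fun _ _ => zero_le_one) _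
  have hG1pos : ∀ n ω, 0 ≤ G1 n ω := fun n ω =>
    mul_nonneg (mul_nonneg (hq0 n ω).le (Real.exp_pos _).le) (hq.mixture_nonneg n ω)
  have hG2pos : ∀ n ω, 0 ≤ G2 n ω := fun n ω =>
    mul_nonneg (mul_nonneg (hq0' n ω).le (Real.exp_pos _).le) (hq'.mixture_nonneg n ω)
  have hI1m : ∀ n, Measurable (I1 n) := fun n =>
    measurable_const.indicator (hq.measurableSet_typical τ n).compl
  have hI2m : ∀ n, Measurable (I2 n) := fun n =>
    measurable_const.indicator (hq'.measurableSet_typical τ n).compl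
  have hG1m : ∀ n, Measurable (G1 n) := fun n =>
    (((hq.measurable_power n).mono (hq.le n) le_rfl).mul
      (((hq.measurable_info n).mono (hq.le n) le_rfl).const_mul (-c)).exp).mul
      ((hq.measurable_mixture n).mono (hq.le n) le_rfl)
  have hG2m : ∀ n, Measurable (G2 n) := fun n =>
    (((hq'.measurable_power n).mono (hq'.le n) le_rfl).mul
      (((hq'.measurable_info n).mono (hq'.le n) le_rfl).const_mul (-c')).exp).mul
      ((hq'.measurable_mixture n).mono (hq'.le n) le_rfl)
  set H : ℕ → Ω → ℝ≥0∞ := fun n ω => ENNReal.ofReal (I1 n ω) + ENNReal.ofReal (I2 n ω) +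
    ENNReal.ofReal C * ENNReal.ofReal (G1 n ω) + ENNReal.ofReal C' * ENNReal.ofReal (G2 n ω) with hH
  have hHm : ∀ n, Measurable (H n) := fun n => by
    have := hI1m n; have := hI2m n; have := hG1m n; have := hG2m n
    fun_prop
  have hHeq : ∀ n ω, H n ω = ENNReal.ofReal (I1 n ω + I2 n ω + C * G1 n ω + C' * G2 n ω) :=
    fun n ω => by
      have h1 := hI1pos n ω
      have h2 := hI2pos n ω
      have h3 := hG1pos n ω
      have h4 := hG2pos n ω
      rw [ENNReal.ofReal_add (by positivity) (by positivity),
        ENNReal.ofReal_add (by positivity) (by positivity), ENNReal.ofReal_add h1 h2,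
        ENNReal.ofReal_mul hC.le, ENNReal.ofReal_mul hC'.le]
  have hpw : ∀ᵐ ω ∂P, ENNReal.ofReal (∑ n ∈ Finset.range T, p n ω k) ≤
      ENNReal.ofReal (B * L + D0) + ∑ n ∈ Finset.Ico 1 T, H n ω := by
    filter_upwards [hpath] with ω hω
    have hJ : ∀ n ω, 0 ≤ I1 n ω + I2 n ω + C * G1 n ω + C' * G2 n ω := fun n ω => by
      have h1 := hI1pos n ω
      have h2 := hI2pos n ω
      have h3 := hG1pos n ω
      have h4 := hG2pos n ω
      positivity
    simp only [hHeq]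
    rw [← ENNReal.ofReal_sum_of_nonneg fun n _ => hJ n ω,
      ← ENNReal.ofReal_add (by positivity) (Finset.sum_nonneg fun n _ => hJ n ω)]
    refine ENNReal.ofReal_le_ofReal ?_
    set R : ℕ → ℝ := fun n => C' * (q' n ω * Real.exp (-c' * info q' n ω)) +
        (if info q n ω ≤ B * L then q n ω else 0) + (Real.exp (-L) + C' * ρ ^ n) with hR
    have hRpos : ∀ n, 0 ≤ R n := fun n => by
      have h1 := (hq0 n ω).le
      have h2 := (hq0' n ω).le
      have h3 : (0 : ℝ) ≤ if info q n ω ≤ B * L then q n ω else 0 := by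
        split_ifs
        · exact h1
        · exact le_rfl
      positivity
    have hRsum : ∑ n ∈ Finset.range T, R n ≤ C' * E' + (B * L + 1) + (1 + C' * (1 - ρ)⁻¹) := by
      rw [Finset.sum_add_distrib, Finset.sum_add_distrib, Finset.sum_add_distrib, ← Finset.mul_sum,
        ← Finset.mul_sum]
      gcongr
      · exact sum_mul_exp_neg_le hc' (fun n => q' n ω) (fun n => (hq0' n ω).le)
          (fun n => hq1' n ω) T
      · exact sum_ite_le (q := fun n => q n ω) (fun n => (hq0 n ω).le) (fun n => hq1 n ω)
          (by positivity) T
      · rw [Finset.sum_const, Finset.card_range, nsmul_eq_mul, Real.exp_neg, hL,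
          Real.exp_log hTpos, mul_inv_cancel₀ hTpos.ne']
      · exact (summable_geometric_of_lt_one hρ0 hρ1).sum_le_tsum _ (fun n _ => by positivity)
          |>.trans (tsum_geometric_of_lt_one hρ0 hρ1).le
    have hterm : ∀ n, p n ω k ≤ (if n < N + 1 then 1 else 0) + R n +
        (if 1 ≤ n then I1 n ω + I2 n ω + C * G1 n ω + C' * G2 n ω else 0) := fun n => by
      have h1 := hRpos n
      have h2 := hJ n ω
      by_cases hn : n < N + 1
      · have h3 : (0 : ℝ) ≤ if 1 ≤ n then I1 n ω + I2 n ω + C * G1 n ω + C' * G2 n ω else 0 := by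
          split_ifs
          · exact h2
          · exact le_rfl
        rw [if_pos hn]
        linarith [hp.le_one n ω k]
      · have h3 := hω L hT n (by omega)
        rw [if_neg hn, if_pos (by omega)]
        linarith
    have hN : ∑ n ∈ Finset.range T, (if n < N + 1 then (1 : ℝ) else 0) ≤ N + 1 := by
      rw [← Finset.sum_filter, Finset.sum_const, nsmul_eq_mul, mul_one]
      have : (Finset.range T).filter (· < N + 1) ⊆ Finset.range (N + 1) := fun n hn =>
        Finset.mem_range.2 (Finset.mem_filter.1 hn).2
      have := Finset.card_le_card this
      rw [Finset.card_range] at this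
      exact_mod_cast this
    have hI : ∑ n ∈ Finset.range T,
        (if 1 ≤ n then I1 n ω + I2 n ω + C * G1 n ω + C' * G2 n ω else 0) =
        ∑ n ∈ Finset.Ico 1 T, (I1 n ω + I2 n ω + C * G1 n ω + C' * G2 n ω) := by
      rw [← Finset.sum_filter]
      congr 1
      ext n
      simp [and_comm]
    calc ∑ n ∈ Finset.range T, p n ω k ≤ _ := Finset.sum_le_sum fun n _ => hterm n
      _ ≤ _ := by
        rw [Finset.sum_add_distrib, Finset.sum_add_distrib, hI]
        linarith
  have hG1sum : ∑ n ∈ Finset.Ico 1 T, ∫⁻ ω, ENNReal.ofReal (G1 n ω) ∂P ≤ ENNReal.ofReal E :=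
    (Finset.sum_le_sum_of_subset fun n hn => Finset.mem_range.2 (Finset.mem_Ico.1 hn).2).trans
      (hq.sum_lintegral_mixture_le hc T)
  have hG2sum : ∑ n ∈ Finset.Ico 1 T, ∫⁻ ω, ENNReal.ofReal (G2 n ω) ∂P ≤ ENNReal.ofReal E' :=
    (Finset.sum_le_sum_of_subset fun n hn => Finset.mem_range.2 (Finset.mem_Ico.1 hn).2).trans
      (hq'.sum_lintegral_mixture_le hc' T)
  have hind : ∀ (A : ℕ → Set Ω) (β : ℕ → ℝ), (∀ n, 0 ≤ β n) → Summable β →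
      (∀ n, MeasurableSet (A n)) → (∀ n, 1 ≤ n → P (A n) ≤ ENNReal.ofReal (β n)) →
      ∑ n ∈ Finset.Ico 1 T, ∫⁻ ω, ENNReal.ofReal ((A n).indicator (fun _ => (1 : ℝ)) ω) ∂P ≤
        ENNReal.ofReal (∑' n, β n) := fun A β hβ hβs hA hAβ => by
    calc _ ≤ ∑ n ∈ Finset.Ico 1 T, ENNReal.ofReal (β n) := by
          refine Finset.sum_le_sum fun n hn => ?_
          have : ∀ ω, ENNReal.ofReal ((A n).indicator (fun _ => (1 : ℝ)) ω) =
              (A n).indicator 1 ω := fun ω => by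
            by_cases h : ω ∈ A n <;> simp [h]
          simp only [this]
          rw [lintegral_indicator_one (hA n)]
          exact hAβ n (Finset.mem_Ico.1 hn).1
      _ = ENNReal.ofReal (∑ n ∈ Finset.Ico 1 T, β n) :=
          (ENNReal.ofReal_sum_of_nonneg fun n _ => hβ n).symm
      _ ≤ _ := ENNReal.ofReal_le_ofReal (hβs.sum_le_tsum _ fun n _ => hβ n)
  have hI1sum := hind _ b hb0 hbs (fun n => (hq.measurableSet_typical τ n).compl) hb
  have hI2sum := hind _ b' hb0' hbs' (fun n => (hq'.measurableSet_typical τ n).compl) hb'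
  calc _ ≤ ∫⁻ ω, (ENNReal.ofReal (B * L + D0) + ∑ n ∈ Finset.Ico 1 T, H n ω) ∂P :=
        lintegral_mono_ae hpw
    _ = ENNReal.ofReal (B * L + D0) + ∑ n ∈ Finset.Ico 1 T, ∫⁻ ω, H n ω ∂P := by
        rw [lintegral_add_left measurable_const, lintegral_const, measure_univ, mul_one,
          lintegral_finsetSum _ fun n _ => hHm n]
    _ = ENNReal.ofReal (B * L + D0) + (∑ n ∈ Finset.Ico 1 T, ∫⁻ ω, ENNReal.ofReal (I1 n ω) ∂P +
          ∑ n ∈ Finset.Ico 1 T, ∫⁻ ω, ENNReal.ofReal (I2 n ω) ∂P +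
          ENNReal.ofReal C * ∑ n ∈ Finset.Ico 1 T, ∫⁻ ω, ENNReal.ofReal (G1 n ω) ∂P +
          ENNReal.ofReal C' * ∑ n ∈ Finset.Ico 1 T, ∫⁻ ω, ENNReal.ofReal (G2 n ω) ∂P) := by
        rw [Finset.mul_sum, Finset.mul_sum, ← Finset.sum_add_distrib, ← Finset.sum_add_distrib,
          ← Finset.sum_add_distrib]
        congr 1
        refine Finset.sum_congr rfl fun n _ => ?_
        have m1 := hI1m n
        have m2 := hI2m n
        have m3 := hG1m n
        have m4 := hG2m n
        rw [← lintegral_const_mul _ (by fun_prop), ← lintegral_const_mul _ (by fun_prop),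
          ← lintegral_add_left (by fun_prop), ← lintegral_add_left (by fun_prop),
          ← lintegral_add_left (by fun_prop)]
    _ ≤ ENNReal.ofReal (B * L + D0) + (ENNReal.ofReal (∑' n, b n) + ENNReal.ofReal (∑' n, b' n) +
          ENNReal.ofReal C * ENNReal.ofReal E + ENNReal.ofReal C' * ENNReal.ofReal E') := by
        gcongr
        · exact hI1sum
        · exact hI2sum
    _ = _ := by
        rw [← ENNReal.ofReal_mul hC.le, ← ENNReal.ofReal_mul hC'.le,
          ← ENNReal.ofReal_add hbt hbt', ← ENNReal.ofReal_add (by positivity) (by positivity),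
          ← ENNReal.ofReal_add (by positivity) (by positivity),
          ← ENNReal.ofReal_add (by positivity) (by positivity), add_assoc]

lemma ae_power_nonneg [IsProbabilityMeasure P] (hX : IsOutcome P μ σ p X) : ∀ᵐ ω ∂P, ∀ n k, 0 ≤ p n ω k := by
  filter_upwards [hX.ae_pos] with ω hω n k using (hω n k).le

lemma integrable_power [IsProbabilityMeasure P] (hσ : ∀ k, 0 < σ k) (hX : IsOutcome P μ σ p X) (hp : IsWTS p X) (n : ℕ)
    (k : Fin K) : Integrable (fun ω => p n ω k) P := by
  obtain ⟨q, hqm, hq0, hq1, hqp⟩ := hX.exists_measurable_power hσ hp.le_one k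
  have h1 : Integrable (q n) P := by
    refine Integrable.of_bound ((hqm n).mono (hX.past_le n) le_rfl).aestronglyMeasurable 1
      (ae_of_all _ fun ω => ?_)
    rw [Real.norm_eq_abs, abs_of_pos (hq0 n ω)]
    exact hq1 n ω
  refine h1.congr ?_
  filter_upwards [hqp] with ω hω using hω n

lemma exists_integral_power_le [IsProbabilityMeasure P] (hσ : ∀ k, 0 < σ k) (hX : IsOutcome P μ σ p X) (hp : IsWTS p X)
    {k k' : Fin K} (hk : ‖μ k‖ < ‖μ k'‖) {B : ℝ} (hB : σ k ^ 2 / (‖μ k'‖ - ‖μ k‖) ^ 2 < B) :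
    ∃ D : ℝ, ∀ T : ℕ, 2 ≤ Real.log T →
      ∫ ω, ∑ n ∈ Finset.range T, p n ω k ∂P ≤ B * Real.log T + D := by
  obtain ⟨D, hD⟩ := exists_lintegral_power_le hσ hX hp hk hB
  have hB0 : 0 ≤ B := le_trans (by positivity) hB.le
  refine ⟨max D 0, fun T hT => ?_⟩
  rw [integral_eq_lintegral_of_nonneg_ae]
  · refine ENNReal.toReal_le_of_le_ofReal ?_ ((hD T hT).trans (ENNReal.ofReal_le_ofReal ?_))
    · have : 0 ≤ Real.log T := by linarith
      positivity
    · gcongr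
      exact le_max_left _ _
  · filter_upwards [ae_power_nonneg hX] with ω hω
    exact Finset.sum_nonneg fun n _ => hω n k
  · exact (integrable_finsetSum _ fun n _ => integrable_power hσ hX hp n k).aestronglyMeasurable

end WeightedBandit

theorem mainTheorem1 {Ω : Type*} [MeasurableSpace Ω] (P : Measure Ω) [IsProbabilityMeasure P]
    {K : ℕ} (μ : Fin K → ℂ) (σ : Fin K → ℝ) (hσ : ∀ k, 0 < σ k)
    (kstar : Fin K) (hopt : ∀ k, k ≠ kstar → ‖μ k‖ < ‖μ kstar‖)
    (p : ℕ → Ω → Fin K → ℝ) (X : ℕ → Ω → Fin K → ℂ)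
    (hX : WeightedBandit.IsOutcome P μ σ p X) (hp : WeightedBandit.IsWTS p X) :
    (∀ T, Integrable (WeightedBandit.regret μ kstar p T) P) ∧
    limsup (fun T : ℕ =>
        ((((∫ ω, WeightedBandit.regret μ kstar p T ω ∂P) / Real.log T : ℝ)) : EReal)) atTop
      ≤ ((∑ k ∈ Finset.univ.erase kstar, σ k ^ 2 / WeightedBandit.gap μ kstar k : ℝ) : EReal) := by
  have hint := WeightedBandit.integrable_power hσ hX hp
  have hreg : ∀ T ω, WeightedBandit.regret μ kstar p T ω =
      ∑ k ∈ Finset.univ.erase kstar, WeightedBandit.gap μ kstar k * ∑ n ∈ Finset.range T, p n ω k :=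
    fun T ω => by
      rw [WeightedBandit.regret, Finset.sum_comm, ← Finset.add_sum_erase _ _ (Finset.mem_univ kstar)]
      simp [WeightedBandit.gap, Finset.mul_sum]
  have hintk : ∀ T k, Integrable
      (fun ω => WeightedBandit.gap μ kstar k * ∑ n ∈ Finset.range T, p n ω k) P := fun T k =>
    (integrable_finsetSum _ fun n _ => hint n k).const_mul _
  refine ⟨fun T => ?_, ?_⟩
  · rw [funext (hreg T)]
    exact integrable_finsetSum _ fun k _ => hintk T k
  set S := ∑ k ∈ Finset.univ.erase kstar, σ k ^ 2 / WeightedBandit.gap μ kstar k with hS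
  refine EReal.le_of_forall_lt_iff_le.1 fun z hz => ?_
  have hz : S < z := by exact_mod_cast hz
  have hK : (0 : ℝ) < K := by exact_mod_cast kstar.pos
  -- Each arm may exceed its constant by `τ`, written `τ / gap` before multiplication by the gap.
  -- Together this uses at most half of `z - S`; the other half absorbs `E / log T`.
  set τ := (z - S) / (2 * K) with hτ
  have hτ0 : 0 < τ := div_pos (by linarith) (by linarith)
  have hgap : ∀ k, k ≠ kstar → 0 < WeightedBandit.gap μ kstar k := fun k hk => sub_pos.2 (hopt k hk)
  have hD : ∀ k, ∃ D : ℝ, k ≠ kstar → ∀ T : ℕ, 2 ≤ Real.log T →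
      ∫ ω, ∑ n ∈ Finset.range T, p n ω k ∂P ≤ (σ k ^ 2 / WeightedBandit.gap μ kstar k ^ 2 +
        τ / WeightedBandit.gap μ kstar k) * Real.log T + D := fun k => by
    by_cases hk : k = kstar
    · exact ⟨0, fun h => absurd hk h⟩
    · obtain ⟨D, hD⟩ := WeightedBandit.exists_integral_power_le hσ hX hp (hopt k hk)
        (lt_add_of_pos_right (σ k ^ 2 / WeightedBandit.gap μ kstar k ^ 2) (div_pos hτ0 (hgap k hk)))
      exact ⟨D, fun _ => hD⟩
  choose D hD using hD
  set E := ∑ k ∈ Finset.univ.erase kstar, WeightedBandit.gap μ kstar k * D k with hE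
  have hlog : Tendsto (fun T : ℕ => Real.log T) atTop atTop :=
    Real.tendsto_log_atTop.comp tendsto_natCast_atTop_atTop
  refine limsup_le_of_le (by isBoundedDefault) ?_
  filter_upwards [hlog.eventually_ge_atTop 2, hlog.eventually_ge_atTop (E / ((z - S) / 2))]
    with T hT hT2
  have hLpos : 0 < Real.log T := by linarith
  rw [EReal.coe_le_coe_iff, div_le_iff₀ hLpos]
  have hsub : ∫ ω, WeightedBandit.regret μ kstar p T ω ∂P ≤ ∑ k ∈ Finset.univ.erase kstar,
      ((σ k ^ 2 / WeightedBandit.gap μ kstar k + τ) * Real.log T +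
        WeightedBandit.gap μ kstar k * D k) := by
    simp only [hreg]
    rw [integral_finsetSum _ fun k _ => hintk T k]
    refine Finset.sum_le_sum fun k hk => ?_
    have hk := Finset.ne_of_mem_erase hk
    have hg := hgap k hk
    rw [integral_const_mul]
    refine (mul_le_mul_of_nonneg_left (hD k hk T hT) hg.le).trans (le_of_eq ?_)
    field_simp
  rw [Finset.sum_add_distrib, ← Finset.sum_mul, Finset.sum_add_distrib, ← hS, ← hE, Finset.sum_const,
    nsmul_eq_mul] at hsub
  have hcard : ((Finset.univ.erase kstar).card : ℝ) * τ ≤ (z - S) / 2 := by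
    have h1 : (Finset.univ.erase kstar).card ≤ K := by
      simp
    calc ((Finset.univ.erase kstar).card : ℝ) * τ ≤ K * τ := by gcongr
      _ = _ := by rw [hτ]; field_simp
  rw [div_le_iff₀ (by linarith)] at hT2
  nlinarith
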